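/- Let $n\ge 1$ be an integer and let $\alpha,\beta>-1$ be real numbers with $\alpha+\beta\ge -1$. For $k\ge 0$ let $P_k^{(\alpha,\beta)}$ be the Jacobi polynomial of degree $k$, orthogonal on $[-1,1]$ with respect to the weight $(1-x)^\alpha(1+x)^\beta$ and normalized by $P_k^{(\alpha,\beta)}(1)=\binom{k+\alpha}{k}$; explicitly $$P_k^{(\alpha,\beta)}(x)=\sum_{l=0}^{k}\frac{(k+\alpha+\beta+1)_l\,(\alpha+l+1)_{k-l}}{l!\,(k-l)!}\Big(\frac{x-1}{2}\Big)^l ,$$ where $(a)_l=a(a+1)\cdots(a+l-1)$. Let $\rho_0=-1$, $\rho_n=1$, and let $\rho_1,\dots,\rho_{n-1}$ be the roots of $P_{n-1}^{(\alpha+1,\beta+1)}$ listed with multiplicity in any order (these roots are all real). Let $\ell_0,\dots,\ell_n$ be the Lagrange polynomials for the nodes $\rho_0,\dots,\rho_n$. Then there is exactly one $(n+1)\times(n+1)$ real matrix $L=(L_{ij})_{0\le i,j\le n}$ with $\ell_j=\sum_{i=0}^{n}L_{ij}P_i^{(\alpha,\beta)}$ for all $j$. Let $\hat L$ be the $n\times(n+1)$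 matrix formed by the first $n$ rows of $L$, and let $\|\hat L\|_\infty$ be its maximal absolute row sum. Then $$\|\hat L\|_\infty\;\le\; 12+(n-1)\,\max_{1\le j\le n-1}\left|\frac{w_j}{1-\rho_j^2}\right|\cdot\frac{2n+\alpha+\beta+1}{2^{\alpha+\beta+1}}\binom{\alpha+\beta+n-1}{\max\{\alpha,\beta\}},$$ where $w_1,\dots,w_{n-1}$ are the Gauss–Jacobi quadrature weights at $\rho_1,\dots,\rho_{n-1}$, that is $w_j=\int_{-1}^1\lambda_j(x)(1-x)^{\alpha+1}(1+x)^{\beta+1}\,dx$ with $\lambda_j$ the $j$-th Lagrange polynomial for the nodes $\rho_1,\dots,\rho_{n-1}$, and $\binom{x}{y}=\frac{\Gamma(x+1)}{\Gamma(y+1)\Gamma(x-y+1)}$. For $n=1$ the second term is $0$. -/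

import Mathlib

open Polynomial

-- The norm on real matrices is the operator norm induced by the sup norm, i.e. the maximal
-- absolute row sum.
attribute [local instance] Matrix.linftyOpNormedAddCommGroup

/-- The Jacobi polynomial `P_k^{(α,β)}`,
`∑_{l ≤ k} (k+α+β+1)_l (α+l+1)_{k-l} / (l! (k-l)!) ((x-1)/2)^l`, with rising factorials `(a)_l`;
it is normalized by `P_k^{(α,β)}(1) = binom(k+α, k)`. -/
noncomputable def jacobiPoly (α β : ℝ) (k : ℕ) : ℝ[X] :=
  ∑ l ∈ Finset.range (k + 1),
    C ((ascPochhammer ℝ l).eval ((k : ℝ) + α + β + 1)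
        * (ascPochhammer ℝ (k - l)).eval (α + (l : ℝ) + 1)
        / ((Nat.factorial l : ℝ) * (Nat.factorial (k - l) : ℝ)))
      * (C (1 / 2 : ℝ) * (X - 1)) ^ l

/-- The binomial coefficient with real entries, `Γ(x+1) / (Γ(y+1) Γ(x-y+1))`. -/
noncomputable def realBinom (x y : ℝ) : ℝ :=
  Real.Gamma (x + 1) / (Real.Gamma (y + 1) * Real.Gamma (x - y + 1))

/-- The interior indices `1, …, n-1` among `0, …, n`. -/
def interiorIdx (n : ℕ) : Finset (Fin (n + 1)) :=
  Finset.univ.filter fun j => j ≠ 0 ∧ j ≠ Fin.last n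

/-- `ρ_0 = -1`, `ρ_n = 1`, and `ρ_1, …, ρ_{n-1}` list the roots of `P_{n-1}^{(α+1,β+1)}`
(with multiplicity, in any order). -/
structure IsJacobiNodes (α β : ℝ) (n : ℕ) (ρ : Fin (n + 1) → ℝ) : Prop where
  first : ρ 0 = -1
  last : ρ (Fin.last n) = 1
  interior : (interiorIdx n).val.map ρ = (jacobiPoly (α + 1) (β + 1) (n - 1)).roots

/-- `L` is the matrix whose `(i,j)` entry is the coefficient of `φ_i` in the expansion with
respect to `φ_0, …, φ_n` of the `j`-th Lagrange polynomial for the nodes `ρ_0, …, ρ_n`. -/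
def IsLagrangeCoeffMatrix (φ : ℕ → ℝ[X]) {n : ℕ} (ρ : Fin (n + 1) → ℝ)
    (L : Matrix (Fin (n + 1)) (Fin (n + 1)) ℝ) : Prop :=
  ∀ j, Lagrange.basis Finset.univ ρ j = ∑ i, C (L i j) * φ i

/-- The first `n` rows of an `(n+1) × (n+1)` matrix. -/
def firstRows {n : ℕ} (L : Matrix (Fin (n + 1)) (Fin (n + 1)) ℝ) :
    Matrix (Fin n) (Fin (n + 1)) ℝ :=
  L.submatrix Fin.castSucc id

/-- The weight `w_j` at the interior node `ρ_j` of the interpolatory quadrature rule on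
`ρ_1, …, ρ_{n-1}` for the weight function `(1-x)^(α+1) (1+x)^(β+1)` on `[-1,1]`. If
`ρ_1, …, ρ_{n-1}` are the roots of `P_{n-1}^{(α+1,β+1)}`, this is the Gauss-Jacobi weight. -/
noncomputable def gaussJacobiWeight (α β : ℝ) {n : ℕ} (ρ : Fin (n + 1) → ℝ)
    (j : Fin (n + 1)) : ℝ :=
  ∫ x in (-1 : ℝ)..1,
    (Lagrange.basis (interiorIdx n) ρ j).eval x * ((1 - x) ^ (α + 1) * (1 + x) ^ (β + 1))

/-! Write `h_i` for the squared norm of `P_i` and `⟨·,·⟩` for the inner product with the Jacobi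
weight. Orthogonality forces `L i j = ⟨ℓ_j, P_i⟩ / h_i`, which gives uniqueness; existence holds
because each `P_i` has exact degree `i`. The nodes are those of Gauss–Lobatto quadrature, so for `i
< n` the product `ℓ_j P_i` is integrated exactly and `L i j = ω_j P_i(ρ_j) / h_i` with `ω_j = ∫ ℓ_j
w` (`IsJacobiNodes.apply_eq_of_lt`). Row `n` lies outside the exactness range, hence the restriction
to the first `n` rows.

At an interior node `ω_j = w_j / (1 - ρ_j²)`. There `|P_i|` is at most its larger end point value,
by Sonine's function (`sq_eval_jacobiPoly_succ_le`). Over `h_i` this bound is a Gamma quotient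
increasing in `i`, so `i = n - 1` is the worst case (`abs_eval_jacobiPoly_div_le`). At the end
points `ω_j` has a closed form, and each contributes at most 2 to a row (`endpoint_weight_mul_le`),
so 4 would do in place of 12.

The classical facts all rest on one differential relation, `jacobiPoly_rodrigues_step`: it yields
reflection, orthogonality, norms, location of the zeros and the differential equation. -/

/-- The rising factorial `(a)_n`. -/
noncomputable def rising (a : ℝ) (n : ℕ) : ℝ := (ascPochhammer ℝ n).eval a

@[simp] theorem rising_zero (a : ℝ) : rising a 0 = 1 := by simp [rising]

theorem rising_succ (a : ℝ) (n : ℕ) : rising a (n + 1) = rising a n * (a + n) :=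
  ascPochhammer_succ_eval n a

theorem rising_succ_left (a : ℝ) (n : ℕ) : rising a (n + 1) = a * rising (a + 1) n := by
  simp [rising, ascPochhammer_succ_left]

theorem rising_pos {a : ℝ} (ha : 0 < a) (n : ℕ) : 0 < rising a n := ascPochhammer_pos n a ha

theorem rising_neg_self (n : ℕ) : rising (-(n : ℝ)) n = (-1) ^ n * (n.factorial : ℝ) := by
  induction n with
  | zero => simp
  | succ n ih =>
    rw [rising_succ_left, show -((n + 1 : ℕ) : ℝ) + 1 = -(n : ℝ) by push_cast; ring, ih,
      Nat.factorial_succ]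
    push_cast; ring

theorem rising_neg_of_lt {m n : ℕ} (h : m < n) : rising (-(m : ℝ)) n = 0 :=
  ascPochhammer_eval_neg_coe_nat_of_lt h

theorem rising_one (n : ℕ) : rising 1 n = n.factorial := ascPochhammer_eval_one ℝ n

theorem rising_mul_Gamma {a : ℝ} (ha : 0 < a) (n : ℕ) :
    rising a n * Real.Gamma a = Real.Gamma (a + n) := by
  induction n with
  | zero => simp
  | succ n ih =>
    rw [rising_succ, mul_right_comm, ih, Nat.cast_succ, ← add_assoc,
      Real.Gamma_add_one (by positivity), mul_comm]

theorem rising_mono {a b : ℝ} (ha : 0 < a) (hab : a ≤ b) (n : ℕ) : rising a n ≤ rising b n := by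
  induction n with
  | zero => simp
  | succ n ih =>
    rw [rising_succ, rising_succ]
    have := rising_pos (ha.trans_le hab) n
    gcongr

/-! ### Jacobi polynomials: coefficients, derivative, Rodrigues relation, reflection -/

/-- The coefficients of a Jacobi polynomial in powers of `(x-1)/2`. -/
noncomputable def jacobiCoeff (α β : ℝ) (k l : ℕ) : ℝ :=
  rising ((k : ℝ) + α + β + 1) l * rising (α + (l : ℝ) + 1) (k - l) /
    ((Nat.factorial l : ℝ) * (Nat.factorial (k - l) : ℝ))

theorem jacobiPoly_eq (α β : ℝ) (k : ℕ) :
    jacobiPoly α β k = ∑ l ∈ Finset.range (k + 1),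
      C (jacobiCoeff α β k l) * (C (1 / 2 : ℝ) * (X - 1)) ^ l := rfl

theorem eval_jacobiPoly (α β : ℝ) (k : ℕ) (x : ℝ) :
    (jacobiPoly α β k).eval x =
      ∑ l ∈ Finset.range (k + 1), jacobiCoeff α β k l * ((x - 1) / 2) ^ l := by
  rw [jacobiPoly_eq, eval_finsetSum]
  refine Finset.sum_congr rfl fun l _ => ?_
  simp; left; ring

@[simp] theorem jacobiPoly_zero (α β : ℝ) : jacobiPoly α β 0 = 1 := by
  simp [jacobiPoly_eq, jacobiCoeff]

theorem natDegree_jacobiPoly_le (α β : ℝ) (k : ℕ) : (jacobiPoly α β k).natDegree ≤ k := by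
  rw [jacobiPoly_eq]
  refine natDegree_sum_le_of_forall_le _ _ fun l hl => ?_
  have hl : l ≤ k := Nat.lt_succ_iff.mp (Finset.mem_range.mp hl)
  refine (natDegree_C_mul_le _ _).trans (natDegree_pow_le.trans ?_)
  have : (C (1 / 2 : ℝ) * (X - 1)).natDegree ≤ 1 :=
    (natDegree_C_mul_le _ _).trans (by simpa using (natDegree_X_sub_C (1 : ℝ)).le)
  nlinarith

theorem eval_one_jacobiPoly (α β : ℝ) (k : ℕ) :
    (jacobiPoly α β k).eval 1 = rising (α + 1) k / k.factorial := by
  rw [eval_jacobiPoly, Finset.sum_eq_single 0]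
  · simp [jacobiCoeff]
  · intro l _ hl; simp [hl]
  · simp

theorem jacobiCoeff_succ_succ (α β : ℝ) (k l : ℕ) :
    jacobiCoeff α β (k + 1) (l + 1) * (l + 1) =
      (k + α + β + 2) * jacobiCoeff (α + 1) (β + 1) k l := by
  rw [jacobiCoeff, jacobiCoeff, rising_succ_left, Nat.add_sub_add_right, Nat.factorial_succ]
  rw [show ((k + 1 : ℕ) : ℝ) + α + β + 1 = k + α + β + 2 by push_cast; ring,
    show (k : ℝ) + (α + 1) + (β + 1) + 1 = k + α + β + 2 + 1 by ring,
    show α + ((l + 1 : ℕ) : ℝ) + 1 = α + 1 + l + 1 by push_cast; ring]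
  have h1 := Nat.factorial_ne_zero l
  have h2 := Nat.factorial_ne_zero (k - l)
  push_cast
  field_simp

theorem derivative_jacobiPoly_succ (α β : ℝ) (k : ℕ) :
    derivative (jacobiPoly α β (k + 1)) =
      C ((k + α + β + 2) / 2) * jacobiPoly (α + 1) (β + 1) k := by
  rw [jacobiPoly_eq, jacobiPoly_eq, derivative_sum, Finset.sum_range_succ', Finset.mul_sum]
  simp only [pow_zero, mul_one, derivative_C, add_zero]
  refine Finset.sum_congr rfl fun l _ => ?_
  rw [derivative_C_mul, derivative_pow, ← mul_assoc (C _) (C _), ← C_mul,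
    show (k + α + β + 2) / 2 * jacobiCoeff (α + 1) (β + 1) k l
      = jacobiCoeff α β (k + 1) (l + 1) * (((l + 1 : ℕ) : ℝ) * (1 / 2)) by
        push_cast; linear_combination (-1 / 2 : ℝ) * jacobiCoeff_succ_succ α β k l]
  have : derivative (C (1 / 2 : ℝ) * (X - 1)) = C (1 / 2) := by simp
  rw [this, Nat.add_sub_cancel, C_mul, C_mul]
  ring

theorem jacobiCoeff_rodrigues_zero (α β : ℝ) (k : ℕ) :
    (k + 1) * jacobiCoeff α β (k + 1) 0 = (α + 1) * jacobiCoeff (α + 1) (β + 1) k 0 := by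
  simp only [jacobiCoeff, rising_zero, Nat.sub_zero, Nat.factorial_succ, rising_succ_left,
    Nat.factorial_zero, Nat.cast_zero, add_zero]
  have h2 := Nat.factorial_ne_zero k
  push_cast
  field_simp

theorem jacobiCoeff_rodrigues_last (α β : ℝ) (k : ℕ) :
    (k + 1) * jacobiCoeff α β (k + 1) (k + 1) =
      (k + α + β + 2) * jacobiCoeff (α + 1) (β + 1) k k := by
  rw [← jacobiCoeff_succ_succ]; ring

/-- The middle coefficients of the Rodrigues relation in powers of `y = (x-1)/2`, where `1 - x² =
-4y(1+y)`. Writing the degree as `l + m + 1` removes truncated subtraction. -/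
theorem jacobiCoeff_rodrigues_mid (α β : ℝ) (l m : ℕ) :
    (l + m + 1 + 1) * jacobiCoeff α β (l + m + 1 + 1) (l + 1) =
      (l + α + β + 2) * jacobiCoeff (α + 1) (β + 1) (l + m + 1) l +
      (l + α + 2) * jacobiCoeff (α + 1) (β + 1) (l + m + 1) (l + 1) := by
  simp only [jacobiCoeff]
  rw [show l + m + 1 + 1 - (l + 1) = m + 1 by omega, show l + m + 1 - l = m + 1 by omega,
    show l + m + 1 - (l + 1) = m by omega, rising_succ_left _ l, rising_succ _ l]
  push_cast
  rw [show (l : ℝ) + m + 1 + (α + 1) + (β + 1) + 1 = l + m + α + β + 4 by ring,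
    show (l : ℝ) + m + 1 + 1 + α + β + 1 = l + m + α + β + 3 by ring,
    show (l : ℝ) + m + α + β + 3 + 1 = l + m + α + β + 4 by ring,
    show α + (l + 1 : ℝ) + 1 = α + l + 2 by ring,
    show α + 1 + l + 1 = α + l + 2 by ring,
    show α + 1 + (l + 1 : ℝ) + 1 = α + l + 2 + 1 by ring,
    rising_succ_left _ m, Nat.factorial_succ, Nat.factorial_succ]
  have h1 := Nat.factorial_ne_zero l
  have h2 := Nat.factorial_ne_zero m
  push_cast
  field_simp
  ring

/-- The differential relation behind Rodrigues' formula. -/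
theorem jacobiPoly_rodrigues_step (α β : ℝ) (k : ℕ) (x : ℝ) :
    (1 - x ^ 2) * (derivative (jacobiPoly (α + 1) (β + 1) k)).eval x +
      ((β - α) - (α + β + 2) * x) * (jacobiPoly (α + 1) (β + 1) k).eval x =
      -2 * (k + 1) * (jacobiPoly α β (k + 1)).eval x := by
  have hd : (derivative (jacobiPoly (α + 1) (β + 1) k)).eval x =
      ∑ l ∈ Finset.range (k + 1), jacobiCoeff (α + 1) (β + 1) k l *
        (l * ((x - 1) / 2) ^ (l - 1) * (1 / 2)) := by
    rw [jacobiPoly_eq, derivative_sum, eval_finsetSum]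
    refine Finset.sum_congr rfl fun l _ => ?_
    have : derivative (C (1 / 2 : ℝ) * (X - 1)) = C (1 / 2) := by simp
    rw [derivative_C_mul, derivative_pow, this]
    simp
    left; left; ring
  set q := jacobiCoeff (α + 1) (β + 1) k with hq
  have hy : x = 2 * ((x - 1) / 2) + 1 := by ring
  rw [hd, eval_jacobiPoly, eval_jacobiPoly]
  set y := (x - 1) / 2
  have key : ∑ l ∈ Finset.range (k + 1), q l * (l + α + β + 2) * y ^ (l + 1) +
      ∑ l ∈ Finset.range (k + 1), q l * (l + α + 1) * y ^ l =
      (k + 1) * ∑ l ∈ Finset.range (k + 1 + 1), jacobiCoeff α β (k + 1) l * y ^ l := by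
    rw [Finset.sum_range_succ, Finset.sum_range_succ' _ k, Finset.sum_range_succ,
      Finset.sum_range_succ' _ k]
    have h0 := jacobiCoeff_rodrigues_zero α β k
    have h1 := jacobiCoeff_rodrigues_last α β k
    have hm : ∑ l ∈ Finset.range k, q l * (l + α + β + 2) * y ^ (l + 1) +
        ∑ l ∈ Finset.range k, q (l + 1) * (((l + 1 : ℕ) : ℝ) + α + 1) * y ^ (l + 1) =
        (k + 1) * ∑ l ∈ Finset.range k, jacobiCoeff α β (k + 1) (l + 1) * y ^ (l + 1) := by
      rw [Finset.mul_sum, ← Finset.sum_add_distrib]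
      refine Finset.sum_congr rfl fun l hl => ?_
      obtain ⟨m, rfl⟩ := Nat.exists_eq_add_of_lt (Finset.mem_range.mp hl)
      have := jacobiCoeff_rodrigues_mid α β l m
      push_cast at this ⊢
      rw [hq]
      linear_combination (-y ^ (l + 1)) * this
    rw [← hq] at h0 h1
    push_cast at hm ⊢
    linear_combination hm - h0 - y ^ (k + 1) * h1
  rw [mul_assoc, ← key, hy, Finset.mul_sum, Finset.mul_sum, ← Finset.sum_add_distrib,
    ← Finset.sum_add_distrib, Finset.mul_sum]
  refine Finset.sum_congr rfl fun l _ => ?_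
  rcases l with _ | l
  · simp; ring
  · simp only [Nat.add_sub_cancel]; push_cast; ring

/-- The Rodrigues operator changes sign under `x ↦ -x` with `α`, `β` swapped, so induction on `k`
applies; the parameters vary because each step raises them. -/
theorem eval_neg_jacobiPoly (k : ℕ) : ∀ (α β x : ℝ),
    (jacobiPoly α β k).eval (-x) = (-1) ^ k * (jacobiPoly β α k).eval x := by
  induction k with
  | zero => simp
  | succ k ih =>
    intro α β x
    have hcomp : (jacobiPoly (α + 1) (β + 1) k).comp (-X) =
        C ((-1) ^ k) * jacobiPoly (β + 1) (α + 1) k :=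
      Polynomial.funext fun y => by
        rw [eval_comp, eval_neg, eval_X, ih, eval_mul, eval_C]
    have hd := congrArg (fun p => (derivative p).eval x) hcomp
    simp only [derivative_comp, derivative_neg, derivative_X, eval_mul, eval_neg, eval_one,
      eval_comp, eval_X, derivative_C_mul, eval_C] at hd
    have h1 := jacobiPoly_rodrigues_step α β k (-x)
    have h2 := jacobiPoly_rodrigues_step β α k x
    rw [ih] at h1
    have hk : (-2 * ((k : ℝ) + 1)) ≠ 0 := by
      have : (0 : ℝ) < k + 1 := by positivity
      linarith
    refine mul_left_cancel₀ hk ?_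
    rw [← h1]
    linear_combination (-(1 - x ^ 2)) * hd + (-1) ^ (k + 1) * h2

theorem eval_neg_one_jacobiPoly (α β : ℝ) (k : ℕ) :
    (jacobiPoly α β k).eval (-1) = (-1) ^ k * (rising (β + 1) k / k.factorial) := by
  rw [eval_neg_jacobiPoly, eval_one_jacobiPoly]

/-! ### Integration against the Jacobi weight -/

theorem intervalIntegrable_jacobiWeight {a b : ℝ} (ha : -1 < a) (hb : -1 < b) :
    IntervalIntegrable (fun x : ℝ => (1 - x) ^ a * (1 + x) ^ b) MeasureTheory.volume (-1) 1 := by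
  have h1 : IntervalIntegrable (fun x : ℝ => (1 + x) ^ b) MeasureTheory.volume (-1) 0 := by
    have := (intervalIntegral.intervalIntegrable_rpow' (a := 0) (b := 1) hb).comp_add_left 1
    simpa using this
  have h2 : IntervalIntegrable (fun x : ℝ => (1 - x) ^ a) MeasureTheory.volume 0 1 := by
    have := (intervalIntegral.intervalIntegrable_rpow' (a := 1) (b := 0) ha).comp_sub_left 1
    simpa using this
  refine IntervalIntegrable.trans (b := 0) ?_ ?_
  · refine h1.continuousOn_mul ?_
    rw [Set.uIcc_of_le (by norm_num)]
    refine ContinuousOn.rpow_const (by fun_prop) fun x hx => Or.inl ?_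
    have := hx.2
    linarith
  · refine h2.mul_continuousOn ?_
    rw [Set.uIcc_of_le (by norm_num)]
    refine ContinuousOn.rpow_const (by fun_prop) fun x hx => Or.inl ?_
    have := hx.1
    linarith

/-- The shift `x ↦ 1 + x` turns this into a scaled Beta integral, evaluated over `ℂ`. -/
theorem integral_jacobiWeight {a b : ℝ} (ha : -1 < a) (hb : -1 < b) :
    ∫ x in (-1 : ℝ)..1, (1 - x) ^ a * (1 + x) ^ b =
      2 ^ (a + b + 1) * (Real.Gamma (a + 1) * Real.Gamma (b + 1) / Real.Gamma (a + b + 2)) := by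
  have h := Complex.betaIntegral_scaled ((b + 1 : ℝ) : ℂ) ((a + 1 : ℝ) : ℂ) (a := 2) two_pos
  rw [Complex.betaIntegral_eq_Gamma_mul_div _ _ (by simp; linarith) (by simp; linarith)] at h
  have h1 : ∫ x in (0 : ℝ)..2, (x : ℂ) ^ (((b + 1 : ℝ) : ℂ) - 1) *
      (((2 : ℝ) : ℂ) - x) ^ (((a + 1 : ℝ) : ℂ) - 1) =
      ((∫ x in (0 : ℝ)..2, x ^ b * (2 - x) ^ a : ℝ) : ℂ) := by
    rw [← intervalIntegral.integral_ofReal]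
    refine intervalIntegral.integral_congr fun x hx => ?_
    rw [Set.uIcc_of_le (by norm_num)] at hx
    rw [Complex.ofReal_mul, Complex.ofReal_cpow hx.1, Complex.ofReal_cpow (by linarith [hx.2])]
    push_cast
    simp
  have h2 : ∫ x in (-1 : ℝ)..1, (1 - x) ^ a * (1 + x) ^ b =
      ∫ x in (0 : ℝ)..2, x ^ b * (2 - x) ^ a := by
    have := intervalIntegral.integral_comp_add_left (a := -1) (b := 1)
      (fun x : ℝ => x ^ b * (2 - x) ^ a) 1
    norm_num at this
    rw [← this]
    refine intervalIntegral.integral_congr fun x _ => ?_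
    rw [mul_comm, show 2 - (1 + x) = 1 - x by ring]
  rw [h1, Complex.Gamma_ofReal, Complex.Gamma_ofReal, ← Complex.ofReal_add,
    Complex.Gamma_ofReal] at h
  rw [h2]
  have h3 : (((2 : ℝ) : ℂ)) ^ (((b + 1 : ℝ) : ℂ) + ((a + 1 : ℝ) : ℂ) - 1) =
      (((2 : ℝ) ^ (a + b + 1) : ℝ) : ℂ) := by
    rw [Complex.ofReal_cpow (by norm_num)]
    congr 1
    push_cast
    ring
  push_cast at h3 h
  rw [h3] at h
  norm_cast at h
  rw [h, show b + 1 + (a + 1) = a + b + 2 by ring]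
  ring

/-- Integration of a polynomial against the Jacobi weight. -/
noncomputable def jacobiInt (a b : ℝ) (p : ℝ[X]) : ℝ :=
  ∫ x in (-1 : ℝ)..1, p.eval x * ((1 - x) ^ a * (1 + x) ^ b)

theorem intervalIntegrable_eval_mul_jacobiWeight {a b : ℝ} (ha : -1 < a) (hb : -1 < b) (p : ℝ[X]) :
    IntervalIntegrable (fun x : ℝ => p.eval x * ((1 - x) ^ a * (1 + x) ^ b))
      MeasureTheory.volume (-1) 1 :=
  (intervalIntegrable_jacobiWeight ha hb).continuousOn_mul p.continuous.continuousOn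

theorem jacobiInt_add {a b : ℝ} (ha : -1 < a) (hb : -1 < b) (p q : ℝ[X]) :
    jacobiInt a b (p + q) = jacobiInt a b p + jacobiInt a b q := by
  rw [jacobiInt, jacobiInt, jacobiInt, ← intervalIntegral.integral_add
    (intervalIntegrable_eval_mul_jacobiWeight ha hb p)
    (intervalIntegrable_eval_mul_jacobiWeight ha hb q)]
  simp only [eval_add, add_mul]

theorem jacobiInt_C_mul (a b c : ℝ) (p : ℝ[X]) :
    jacobiInt a b (C c * p) = c * jacobiInt a b p := by
  rw [jacobiInt, jacobiInt, ← intervalIntegral.integral_const_mul]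
  simp only [eval_mul, eval_C, mul_assoc]

theorem jacobiInt_sum {a b : ℝ} (ha : -1 < a) (hb : -1 < b) {ι : Type*} (s : Finset ι)
    (p : ι → ℝ[X]) : jacobiInt a b (∑ i ∈ s, p i) = ∑ i ∈ s, jacobiInt a b (p i) := by
  classical
  induction s using Finset.induction_on with
  | empty => simp [jacobiInt]
  | insert i s hi ih => rw [Finset.sum_insert hi, Finset.sum_insert hi, jacobiInt_add ha hb, ih]

/-- The end points are a null set; dropping them keeps the bases `1 ± x` positive, as the power
rules require. -/
theorem integral_congr_Ioo {f g : ℝ → ℝ} (h : ∀ x ∈ Set.Ioo (-1 : ℝ) 1, f x = g x) :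
    ∫ x in (-1 : ℝ)..1, f x = ∫ x in (-1 : ℝ)..1, g x := by
  rw [intervalIntegral.integral_of_le (by norm_num), intervalIntegral.integral_of_le (by norm_num),
    MeasureTheory.integral_Ioc_eq_integral_Ioo, MeasureTheory.integral_Ioc_eq_integral_Ioo]
  exact MeasureTheory.setIntegral_congr_fun measurableSet_Ioo h

theorem jacobiInt_one_sub_mul (a b : ℝ) (p : ℝ[X]) :
    jacobiInt a b ((1 - X) * p) = jacobiInt (a + 1) b p :=
  integral_congr_Ioo fun x hx => by
    rw [Real.rpow_add_one (by linarith [hx.2])]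
    simp
    ring

theorem jacobiInt_one_add_mul (a b : ℝ) (p : ℝ[X]) :
    jacobiInt a b ((1 + X) * p) = jacobiInt a (b + 1) p :=
  integral_congr_Ioo fun x hx => by
    rw [Real.rpow_add_one (by linarith [hx.1])]
    simp
    ring

theorem jacobiInt_comp_neg (a b : ℝ) (p : ℝ[X]) :
    jacobiInt a b (p.comp (-X)) = jacobiInt b a p := by
  have := intervalIntegral.integral_comp_neg (a := -1) (b := 1)
      (fun x : ℝ => p.eval x * ((1 - x) ^ b * (1 + x) ^ a))
  rw [neg_neg] at this
  rw [jacobiInt, jacobiInt, ← this]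
  refine intervalIntegral.integral_congr fun x _ => ?_
  simp [mul_comm, sub_eq_add_neg]

theorem hasDerivAt_jacobiWeight_mul (a b : ℝ) (p : ℝ[X]) {x : ℝ} (hx : x ∈ Set.Ioo (-1 : ℝ) 1) :
    HasDerivAt (fun x : ℝ => p.eval x * ((1 - x) ^ (a + 1) * (1 + x) ^ (b + 1)))
      (((1 - x ^ 2) * (derivative p).eval x + ((b - a) - (a + b + 2) * x) * p.eval x) *
        ((1 - x) ^ a * (1 + x) ^ b)) x := by
  have h1 : (0 : ℝ) < 1 - x := by linarith [hx.2]
  have h2 : (0 : ℝ) < 1 + x := by linarith [hx.1]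
  have d1 := ((hasDerivAt_id x).const_sub 1).rpow_const (p := a + 1) (Or.inl h1.ne')
  have d2 := ((hasDerivAt_id x).const_add 1).rpow_const (p := b + 1) (Or.inl h2.ne')
  refine ((p.hasDerivAt x).mul (d1.mul d2)).congr_deriv ?_
  simp only [Pi.mul_apply, id, add_sub_cancel_right, Real.rpow_add_one h1.ne', Real.rpow_add_one h2.ne']
  ring

/-- The integrand is the derivative of `p (1-x)^(a+1) (1+x)^(b+1)`, which vanishes at `±1` since
both exponents are positive. -/
theorem jacobiInt_derivative {a b : ℝ} (ha : -1 < a) (hb : -1 < b) (p : ℝ[X]) :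
    jacobiInt a b ((1 - X ^ 2) * derivative p + (C (b - a) - C (a + b + 2) * X) * p) = 0 := by
  have h := intervalIntegral.integral_eq_sub_of_hasDerivAt_of_le (a := -1) (b := 1) (by norm_num)
    (f := fun x : ℝ => p.eval x * ((1 - x) ^ (a + 1) * (1 + x) ^ (b + 1)))
    (f' := fun x : ℝ =>
      ((1 - X ^ 2) * derivative p + (C (b - a) - C (a + b + 2) * X) * p).eval x *
        ((1 - x) ^ a * (1 + x) ^ b)) ?_ ?_
    (intervalIntegrable_eval_mul_jacobiWeight ha hb _)
  · rw [jacobiInt, h]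
    have h1 : a + 1 ≠ 0 := by linarith
    have h2 : b + 1 ≠ 0 := by linarith
    simp [Real.zero_rpow h1, Real.zero_rpow h2]
  · refine p.continuous.continuousOn.mul (ContinuousOn.mul ?_ ?_) <;>
      exact ContinuousOn.rpow_const (by fun_prop) fun x _ => Or.inr (by linarith)
  · intro x hx
    refine (hasDerivAt_jacobiWeight_mul a b p hx).congr_deriv ?_
    simp

/-! ### Orthogonality and norms -/

/-- Replacing `α` by `μ` in the Rodrigues relation leaves the defect `(α - μ)(1 + x)` times the
raised polynomial, while the whole expression integrates to zero. -/
theorem jacobiInt_jacobiPoly_succ {α β μ : ℝ} (hβ : -1 < β) (hμ : -1 < μ) (k : ℕ) :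
    jacobiInt μ β (jacobiPoly α β (k + 1)) =
      (α - μ) / (2 * (k + 1)) * jacobiInt μ (β + 1) (jacobiPoly (α + 1) (β + 1) k) := by
  have h := jacobiInt_derivative hμ hβ (jacobiPoly (α + 1) (β + 1) k)
  have hp : (1 - X ^ 2) * derivative (jacobiPoly (α + 1) (β + 1) k) +
      (C (β - μ) - C (μ + β + 2) * X) * jacobiPoly (α + 1) (β + 1) k =
      C (-2 * ((k : ℝ) + 1)) * jacobiPoly α β (k + 1) +
      C (α - μ) * ((1 + X) * jacobiPoly (α + 1) (β + 1) k) := by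
    refine Polynomial.funext fun x => ?_
    have := jacobiPoly_rodrigues_step α β k x
    simp only [eval_add, eval_mul, eval_sub, eval_one, eval_pow, eval_X, eval_C]
    linear_combination this
  rw [hp, jacobiInt_add hμ hβ, jacobiInt_C_mul, jacobiInt_C_mul, jacobiInt_one_add_mul] at h
  have : (k : ℝ) + 1 ≠ 0 := by positivity
  field_simp
  linarith

/-- Keeping `μ` free pays off: at `μ = α + m` the factor `(α - μ)_k = (-m)_k` vanishes for `m < k`,
which is orthogonality, and `m = k` gives the norm. -/
theorem jacobiInt_jacobiPoly (k : ℕ) : ∀ {α β μ : ℝ}, -1 < β → -1 < μ →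
    jacobiInt μ β (jacobiPoly α β k) =
      2 ^ (μ + β + 1) * (Real.Gamma (μ + 1) * Real.Gamma (β + k + 1) /
        Real.Gamma (μ + β + k + 2)) * (rising (α - μ) k / k.factorial) := by
  induction k with
  | zero =>
    intro α β μ hβ hμ
    simp [jacobiInt, integral_jacobiWeight hμ hβ]
  | succ k ih =>
    intro α β μ hβ hμ
    rw [jacobiInt_jacobiPoly_succ hβ hμ, ih (by linarith) hμ, rising_succ_left,
      Nat.factorial_succ, show μ + (β + 1) + 1 = μ + β + 1 + 1 by ring,
      Real.rpow_add_one two_ne_zero, show α + 1 - μ = α - μ + 1 by ring]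
    push_cast
    rw [show β + 1 + k + 1 = β + (k + 1) + 1 by ring,
      show μ + (β + 1) + k + 2 = μ + β + (k + 1) + 2 by ring]
    have h1 := Nat.factorial_ne_zero k
    have h2 : (k : ℝ) + 1 ≠ 0 := by positivity
    field_simp

theorem jacobiInt_mul_one_sub_pow (a b : ℝ) (p : ℝ[X]) (m : ℕ) :
    jacobiInt a b ((1 - X) ^ m * p) = jacobiInt (a + m) b p := by
  induction m generalizing p with
  | zero => simp
  | succ m ih =>
    rw [pow_succ, mul_assoc, ih, jacobiInt_one_sub_mul]
    push_cast
    rw [add_assoc]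

theorem jacobiInt_one_sub_pow_mul_jacobiPoly_of_lt {α β : ℝ} (hα : -1 < α) (hβ : -1 < β)
    {m k : ℕ} (h : m < k) : jacobiInt α β ((1 - X) ^ m * jacobiPoly α β k) = 0 := by
  have : (0 : ℝ) ≤ m := by positivity
  rw [jacobiInt_mul_one_sub_pow, jacobiInt_jacobiPoly k hβ (by linarith),
    show α - (α + m) = -(m : ℝ) by ring, rising_neg_of_lt h]
  simp

theorem jacobiInt_mul_jacobiPoly_of_natDegree_lt {α β : ℝ} (hα : -1 < α) (hβ : -1 < β) {k : ℕ}
    {p : ℝ[X]} (h : p.natDegree < k) : jacobiInt α β (p * jacobiPoly α β k) = 0 := by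
  have hcomp : p = ∑ i ∈ Finset.range (p.natDegree + 1),
      C ((p.comp (1 - X)).coeff i) * (1 - X) ^ i := by
    have h1 : (p.comp (1 - X)).natDegree ≤ p.natDegree := by
      refine natDegree_comp_le.trans ?_
      have : (1 - X : ℝ[X]).natDegree ≤ 1 := by
        refine (natDegree_sub_le _ _).trans ?_
        simp
      nlinarith
    have h2 : p = (p.comp (1 - X)).comp (1 - X) := by
      rw [comp_assoc]; simp
    nth_rewrite 1 [h2]
    rw [comp, eval₂_eq_sum_range' C (Nat.lt_succ_of_le h1)]
  rw [hcomp, Finset.sum_mul, jacobiInt_sum hα hβ]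
  refine Finset.sum_eq_zero fun i hi => ?_
  rw [mul_assoc, jacobiInt_C_mul, jacobiInt_one_sub_pow_mul_jacobiPoly_of_lt hα hβ, mul_zero]
  have := Finset.mem_range.mp hi
  omega

/-- The squared norms of the Jacobi polynomials. -/
theorem jacobiInt_jacobiPoly_mul_self {α β : ℝ} (hα : -1 < α) (hβ : -1 < β) (k : ℕ) :
    jacobiInt α β (jacobiPoly α β k * jacobiPoly α β k) =
      2 ^ (α + β + 1) * rising (k + α + β + 1) k * Real.Gamma (α + k + 1) *
        Real.Gamma (β + k + 1) / (k.factorial * Real.Gamma (α + β + 2 * k + 2)) := by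
  have hexp : jacobiPoly α β k = ∑ l ∈ Finset.range (k + 1),
      C (jacobiCoeff α β k l * (-1 / 2) ^ l) * (1 - X) ^ l := by
    rw [jacobiPoly_eq]
    refine Finset.sum_congr rfl fun l _ => ?_
    rw [C_mul, C_pow, mul_assoc, ← mul_pow]
    congr 2
    rw [show (-1 / 2 : ℝ) = -(1 / 2) by ring, C_neg]
    ring
  -- Expand only one factor in powers of `1 - x`: every term but the top one is orthogonal to the
  -- other factor.
  nth_rewrite 1 [hexp]
  have hk : (0 : ℝ) ≤ k := by positivity
  rw [Finset.sum_mul, jacobiInt_sum hα hβ, Finset.sum_range_succ, Finset.sum_eq_zero, zero_add,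
    mul_assoc, jacobiInt_C_mul, jacobiInt_mul_one_sub_pow, jacobiInt_jacobiPoly k hβ (by linarith),
    show α - (α + k) = -(k : ℝ) by ring, rising_neg_self, jacobiCoeff, Nat.sub_self,
    show α + k + β + 1 = α + β + 1 + k by ring, Real.rpow_add_natCast two_ne_zero,
    show α + k + β + k + 2 = α + β + 2 * k + 2 by ring]
  · have h1 := Nat.factorial_ne_zero k
    have h2 : ((-1 : ℝ) / 2) ^ k * 2 ^ k * (-1) ^ k = 1 := by
      rw [← mul_pow, ← mul_pow]; norm_num
    simp only [rising_zero, Nat.factorial_zero, Nat.cast_one, mul_one]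
    generalize Real.Gamma (α + β + 2 * k + 2) = G
    field_simp
    linear_combination (rising (k + α + β + 1) k * Real.Gamma (α + k + 1) *
      Real.Gamma (β + k + 1) / G) * h2
  · intro l hl
    rw [mul_assoc, jacobiInt_C_mul, jacobiInt_one_sub_pow_mul_jacobiPoly_of_lt hα hβ
      (Finset.mem_range.mp hl), mul_zero]

/-! ### Zeros -/

theorem eval_one_jacobiPoly_pos {α β : ℝ} (hα : -1 < α) (k : ℕ) :
    0 < (jacobiPoly α β k).eval 1 := by
  rw [eval_one_jacobiPoly]
  exact div_pos (rising_pos (by linarith) k) (by positivity)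

theorem jacobiPoly_ne_zero {α β : ℝ} (hα : -1 < α) (k : ℕ) : jacobiPoly α β k ≠ 0 := fun h => by
  have := eval_one_jacobiPoly_pos (β := β) hα k
  simp [h] at this

/-- Rolle's theorem for `F = Q (1-x)^(α+1) (1+x)^(β+1)`: it vanishes at `±1` and at the `k` or more
roots of `Q`, and `F'` is a nonzero multiple of `P_{k+1}` times a positive weight. -/
theorem le_card_roots_jacobiPoly (k : ℕ) : ∀ {α β : ℝ}, -1 < α → -1 < β →
    k ≤ ((jacobiPoly α β k).roots.toFinset.filter (· ∈ Set.Ioo (-1 : ℝ) 1)).card := by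
  induction k with
  | zero => simp
  | succ k ih =>
    intro α β hα hβ
    set Q := jacobiPoly (α + 1) (β + 1) k with hQ
    set F := fun x : ℝ => Q.eval x * ((1 - x) ^ (α + 1) * (1 + x) ^ (β + 1)) with hF
    set s := Q.roots.toFinset.filter (· ∈ Set.Ioo (-1 : ℝ) 1) with hs
    have hcard : (insert (-1) (insert 1 s)).card = s.card + 2 := by
      rw [Finset.card_insert_of_notMem, Finset.card_insert_of_notMem]
      · simp [hs]
      · simp only [Finset.mem_insert, not_or]
        exact ⟨by norm_num, by simp [hs]⟩
    have h0 : ∀ x ∈ insert (-1) (insert 1 s), x ∈ Set.Icc (-1 : ℝ) 1 ∧ F x = 0 := by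
      intro x hx
      simp only [Finset.mem_insert] at hx
      rcases hx with rfl | rfl | hx
      · refine ⟨by simp, ?_⟩
        simp [hF, Real.zero_rpow (show β + 1 ≠ 0 by linarith)]
      · refine ⟨by simp, ?_⟩
        simp [hF, Real.zero_rpow (show α + 1 ≠ 0 by linarith)]
      · rw [hs, Finset.mem_filter, Multiset.mem_toFinset] at hx
        refine ⟨Set.Ioo_subset_Icc_self hx.2, ?_⟩
        have : Q.eval x = 0 := (mem_roots'.mp hx.1).2
        simp [hF, this]
    have hle := Finset.card_le_of_interleaved (s := insert (-1) (insert 1 s))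
      (t := (jacobiPoly α β (k + 1)).roots.toFinset.filter (· ∈ Set.Ioo (-1 : ℝ) 1)) ?_
    · have : k ≤ s.card := ih (by linarith) (by linarith)
      rw [hcard] at hle
      omega
    · intro x hx y hy hxy _
      obtain ⟨hx1, hx2⟩ := h0 x hx
      obtain ⟨hy1, hy2⟩ := h0 y hy
      have hcont : ContinuousOn F (Set.Icc x y) := by
        refine Q.continuous.continuousOn.mul (ContinuousOn.mul ?_ ?_) <;>
          exact ContinuousOn.rpow_const (by fun_prop) fun x _ => Or.inr (by linarith)
      obtain ⟨z, hz, hz0⟩ := exists_hasDerivAt_eq_zero hxy hcont (hx2.trans hy2.symm)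
        (fun z hz => hasDerivAt_jacobiWeight_mul α β Q
          ⟨hx1.1.trans_lt hz.1, hz.2.trans_le hy1.2⟩)
      have hz' : z ∈ Set.Ioo (-1 : ℝ) 1 := ⟨hx1.1.trans_lt hz.1, hz.2.trans_le hy1.2⟩
      refine ⟨z, ?_, hz.1, hz.2⟩
      rw [Finset.mem_filter, Multiset.mem_toFinset, mem_roots (jacobiPoly_ne_zero hα _)]
      refine ⟨?_, hz'⟩
      have h1 := Real.rpow_pos_of_pos (show 0 < 1 - z by linarith [hz'.2]) α
      have h2 := Real.rpow_pos_of_pos (show 0 < 1 + z by linarith [hz'.1]) β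
      have h3 := (mul_eq_zero.mp hz0).resolve_right (mul_pos h1 h2).ne'
      rw [jacobiPoly_rodrigues_step] at h3
      exact (mul_eq_zero.mp h3).resolve_left (by
        have : (0 : ℝ) < k + 1 := by positivity
        linarith)

/-- The distinct roots inside number at least `k` and all roots at most `k`, so every count in
between is equal. -/
theorem roots_jacobiPoly_aux {α β : ℝ} (hα : -1 < α) (hβ : -1 < β) (k : ℕ) :
    (jacobiPoly α β k).roots.card = k ∧ (jacobiPoly α β k).roots.Nodup ∧
      ∀ x ∈ (jacobiPoly α β k).roots, x ∈ Set.Ioo (-1 : ℝ) 1 := by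
  have h1 := le_card_roots_jacobiPoly k hα hβ
  have h2 := Finset.card_filter_le (jacobiPoly α β k).roots.toFinset (· ∈ Set.Ioo (-1 : ℝ) 1)
  have h3 := Multiset.toFinset_card_le (jacobiPoly α β k).roots
  have h4 := (card_roots' (jacobiPoly α β k)).trans (natDegree_jacobiPoly_le α β k)
  refine ⟨by omega, Multiset.toFinset_card_eq_card_iff_nodup.mp (by omega), fun x hx => ?_⟩
  exact Finset.filter_card_eq (p := fun x => x ∈ Set.Ioo (-1 : ℝ) 1) (by omega : _ = (jacobiPoly α β k).roots.toFinset.card) x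
    (Multiset.mem_toFinset.mpr hx)

theorem card_roots_jacobiPoly {α β : ℝ} (hα : -1 < α) (hβ : -1 < β) (k : ℕ) :
    (jacobiPoly α β k).roots.card = k := (roots_jacobiPoly_aux hα hβ k).1

theorem nodup_roots_jacobiPoly {α β : ℝ} (hα : -1 < α) (hβ : -1 < β) (k : ℕ) :
    (jacobiPoly α β k).roots.Nodup := (roots_jacobiPoly_aux hα hβ k).2.1

theorem mem_Ioo_of_mem_roots_jacobiPoly {α β : ℝ} (hα : -1 < α) (hβ : -1 < β) {k : ℕ} {x : ℝ}
    (hx : x ∈ (jacobiPoly α β k).roots) : x ∈ Set.Ioo (-1 : ℝ) 1 :=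
  (roots_jacobiPoly_aux hα hβ k).2.2 x hx

/-! ### Differential equation and the maximum on `[-1,1]` -/

/-- The Jacobi differential equation. -/
theorem jacobiPoly_ode (α β : ℝ) (k : ℕ) (x : ℝ) :
    (1 - x ^ 2) * (derivative (derivative (jacobiPoly α β (k + 1)))).eval x +
      ((β - α) - (α + β + 2) * x) * (derivative (jacobiPoly α β (k + 1))).eval x +
      (k + 1) * (k + α + β + 2) * (jacobiPoly α β (k + 1)).eval x = 0 := by
  have h := jacobiPoly_rodrigues_step α β k x
  rw [derivative_jacobiPoly_succ, derivative_C_mul, eval_C_mul, eval_C_mul]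
  linear_combination (k + α + β + 2) / 2 * h

/-- Sonine's auxiliary function takes its maximum over `[-1,1]` at an end point. -/
theorem sq_eval_jacobiPoly_succ_le {α β : ℝ} (hs : -1 ≤ α + β) (k : ℕ) {x : ℝ}
    (hx : x ∈ Set.Icc (-1 : ℝ) 1) :
    (jacobiPoly α β (k + 1)).eval x ^ 2 ≤
      max ((jacobiPoly α β (k + 1)).eval (-1) ^ 2) ((jacobiPoly α β (k + 1)).eval 1 ^ 2) := by
  set P := jacobiPoly α β (k + 1) with hP
  have hc : (0 : ℝ) < (k + 1) * (k + α + β + 2) := by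
    have : (0 : ℝ) ≤ k := by positivity
    exact mul_pos (by linarith) (by linarith)
  set c : ℝ := (k + 1) * (k + α + β + 2) with hcdef
  -- Sonine's function: it dominates `P²`, agrees with it at `±1`, and the differential equation
  -- makes `f'` a nonnegative square times a linear factor.
  set f : ℝ[X] := P ^ 2 + C c⁻¹ * ((1 - X ^ 2) * derivative P ^ 2) with hf
  have hfd : ∀ y, deriv (fun y => f.eval y) y =
      2 / c * (derivative P).eval y ^ 2 * ((α - β) + (α + β + 1) * y) := by
    intro y
    have ode := jacobiPoly_ode α β k y
    rw [← hP, ← hcdef] at ode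
    rw [Polynomial.deriv, hf]
    simp only [derivative_add, derivative_mul, derivative_pow, derivative_C, derivative_sub,
      derivative_one, derivative_X, eval_add, eval_mul, eval_pow, eval_C, eval_sub, eval_one,
      eval_X, eval_zero, Nat.cast_ofNat]
    field_simp
    norm_num
    linear_combination 2 * (derivative P).eval y * ode
  have hle : P.eval x ^ 2 ≤ f.eval x := by
    have h1 : 0 ≤ 1 - x ^ 2 := by nlinarith [hx.1, hx.2]
    have : 0 ≤ c⁻¹ * ((1 - x ^ 2) * (derivative P).eval x ^ 2) := by positivity
    simpa [hf] using this
  have e1 : f.eval 1 = P.eval 1 ^ 2 := by simp [hf]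
  have e2 : f.eval (-1) = P.eval (-1) ^ 2 := by simp [hf]
  rw [← e1, ← e2]
  refine hle.trans ?_
  -- The linear factor is nondecreasing because `α + β + 1 ≥ 0`, so its sign at `x` persists up to
  -- the end point on that side.
  rcases le_total 0 ((α - β) + (α + β + 1) * x) with h | h
  · refine le_max_of_le_right ?_
    refine monotoneOn_of_deriv_nonneg (convex_Icc x 1) f.continuous.continuousOn
      f.differentiable.differentiableOn (fun y hy => ?_) (Set.left_mem_Icc.mpr hx.2)
      (Set.right_mem_Icc.mpr hx.2) hx.2
    rw [interior_Icc] at hy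
    rw [hfd]
    have : 0 ≤ (α - β) + (α + β + 1) * y := by nlinarith [hy.1]
    positivity
  · refine le_max_of_le_left ?_
    refine antitoneOn_of_deriv_nonpos (convex_Icc (-1) x) f.continuous.continuousOn
      f.differentiable.differentiableOn (fun y hy => ?_) (Set.left_mem_Icc.mpr hx.1)
      (Set.right_mem_Icc.mpr hx.1) hx.1
    rw [interior_Icc] at hy
    rw [hfd]
    have : (α - β) + (α + β + 1) * y ≤ 0 := by nlinarith [hy.2]
    exact mul_nonpos_of_nonneg_of_nonpos (by positivity) this

theorem abs_eval_jacobiPoly_le {α β : ℝ} (hα : -1 < α) (hβ : -1 < β) (hs : -1 ≤ α + β) (k : ℕ)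
    {x : ℝ} (hx : x ∈ Set.Icc (-1 : ℝ) 1) :
    |(jacobiPoly α β k).eval x| ≤ rising (max α β + 1) k / k.factorial := by
  rcases k with _ | k
  · simp
  have hpos : 0 ≤ rising (max α β + 1) (k + 1) / ((k + 1).factorial : ℝ) :=
    div_nonneg (rising_pos (by linarith [le_max_left α β]) _).le (by positivity)
  refine abs_le_of_sq_le_sq ?_ hpos
  refine (sq_eval_jacobiPoly_succ_le hs k hx).trans (max_le ?_ ?_)
  · rw [eval_neg_one_jacobiPoly, mul_pow, ← pow_mul, mul_comm _ 2, pow_mul, neg_one_sq, one_pow,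
      one_mul]
    have h := rising_pos (show 0 < β + 1 by linarith) (k + 1)
    gcongr
    exact rising_mono (by linarith) (by simp) _
  · rw [eval_one_jacobiPoly]
    have h := rising_pos (show 0 < α + 1 by linarith) (k + 1)
    gcongr
    exact rising_mono (by linarith) (by simp) _

/-! ### Existence of the nodes -/

theorem exists_map_val_eq {ι X : Type*} [DecidableEq ι] [Inhabited X] (s : Finset ι) :
    ∀ t : Multiset X, t.card = s.card → ∃ f : ι → X, s.val.map f = t := by
  induction s using Finset.induction_on with
  | empty => intro t ht; exact ⟨fun _ => default, (Multiset.card_eq_zero.mp ht).symm⟩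
  | insert a s ha ih =>
    intro t ht
    rw [Finset.card_insert_of_notMem ha] at ht
    obtain ⟨b, hb⟩ := Multiset.card_pos_iff_exists_mem.mp (by omega : 0 < t.card)
    obtain ⟨t', rfl⟩ := Multiset.exists_cons_of_mem hb
    obtain ⟨f, hf⟩ := ih t' (by simpa using ht)
    refine ⟨Function.update f a b, ?_⟩
    rw [Finset.insert_val_of_notMem ha, Multiset.map_cons, Function.update_self, ← hf]
    congr 1
    refine Multiset.map_congr rfl fun x hx => Function.update_of_ne ?_ _ _
    rintro rfl
    exact ha hx

theorem card_interiorIdx {n : ℕ} (hn : 1 ≤ n) : (interiorIdx n).card = n - 1 := by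
  have : interiorIdx n = (Finset.univ.erase (Fin.last n)).erase 0 := by
    ext j; simp [interiorIdx]
  rw [this, Finset.card_erase_of_mem, Finset.card_erase_of_mem (Finset.mem_univ _)]
  · simp
  · simp only [Finset.mem_erase, Finset.mem_univ, and_true]
    intro h
    have := congrArg Fin.val h
    simp at this
    omega

theorem exists_isJacobiNodes {α β : ℝ} (hα : -1 < α) (hβ : -1 < β) {n : ℕ} (hn : 1 ≤ n) :
    ∃ ρ : Fin (n + 1) → ℝ, IsJacobiNodes α β n ρ := by
  obtain ⟨f, hf⟩ := exists_map_val_eq (interiorIdx n)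
    (jacobiPoly (α + 1) (β + 1) (n - 1)).roots
    (by rw [card_interiorIdx hn, card_roots_jacobiPoly (by linarith) (by linarith)])
  have h0 : (Fin.last n) ≠ 0 := by
    intro h
    have := congrArg Fin.val h
    simp at this
    omega
  refine ⟨fun j => if j = 0 then -1 else if j = Fin.last n then 1 else f j, ?_, ?_, ?_⟩
  · simp
  · simp [h0]
  · rw [← hf]
    refine Multiset.map_congr rfl fun x hx => ?_
    have hx : x ∈ interiorIdx n := hx
    rw [interiorIdx, Finset.mem_filter] at hx
    simp [hx.2.1, hx.2.2]

/-! ### Gamma quotients and the two basic estimates -/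

/-- The base can vanish only for `i = 0`, `s = -1`, and then the product is empty. -/
theorem rising_add_self_pos {s : ℝ} (hs : -1 ≤ s) (i : ℕ) : 0 < rising (i + s + 1) i := by
  rcases i with _ | i
  · simp
  · refine rising_pos ?_ _
    push_cast
    have : (0 : ℝ) ≤ i := by positivity
    linarith

/-- The quotient `Γ(s+2i+2) / (s+i+1)_i`, which is `(s+2i+1) Γ(s+i+1)` for `i ≥ 1`. -/
noncomputable def gammaRatio (s : ℝ) (i : ℕ) : ℝ :=
  Real.Gamma (s + 2 * i + 2) / rising (i + s + 1) i

theorem gammaRatio_pos {s : ℝ} (hs : -1 ≤ s) (i : ℕ) : 0 < gammaRatio s i := by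
  have : (0 : ℝ) ≤ i := by positivity
  exact div_pos (Real.Gamma_pos_of_pos (by linarith)) (rising_add_self_pos hs i)

theorem gammaRatio_succ {s : ℝ} (hs : -1 ≤ s) (i : ℕ) :
    gammaRatio s (i + 1) = (2 * i + s + 3) * Real.Gamma (i + s + 2) := by
  have hi : (0 : ℝ) ≤ i := by positivity
  rw [gammaRatio, div_eq_iff (rising_add_self_pos hs (i + 1)).ne', mul_assoc,
    mul_comm (Real.Gamma _)]
  push_cast
  rw [show (i : ℝ) + 1 + s + 1 = i + s + 2 by ring, rising_mul_Gamma (by linarith)]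
  push_cast
  rw [show s + 2 * ((i : ℝ) + 1) + 2 = (2 * i + s + 3) + 1 by ring,
    Real.Gamma_add_one (by linarith)]
  ring_nf

theorem gammaRatio_div_Gamma_mono_succ {s b : ℝ} (hs : -1 ≤ s) (hb : -1 < b) (hsb : -1 < s - b)
    (i : ℕ) : gammaRatio s i / Real.Gamma (b + i + 1) ≤
      gammaRatio s (i + 1) / Real.Gamma (b + (i + 1 : ℕ) + 1) := by
  have hi : (0 : ℝ) ≤ i := by positivity
  have hG := Real.Gamma_pos_of_pos (show 0 < b + i + 1 by linarith)
  have hb' : 0 < b + i + 1 := by linarith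
  push_cast
  rw [show b + (i + 1 : ℝ) + 1 = b + i + 1 + 1 by ring, Real.Gamma_add_one (s := b + i + 1) hb'.ne',
    gammaRatio_succ hs, div_le_div_iff₀ hG (mul_pos (by linarith) hG), ← mul_assoc]
  refine mul_le_mul_of_nonneg_right ?_ hG.le
  -- The closed form of `gammaRatio` starts at index 1, so the step from 0 to 1 is separate.
  rcases i with _ | i
  · have h := Real.Gamma_pos_of_pos (show 0 < s + 2 by linarith)
    simp only [gammaRatio, Nat.cast_zero, rising_zero, mul_zero, zero_add, add_zero, div_one]
    nlinarith
  · rw [gammaRatio_succ hs]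
    push_cast at *
    have hi' : (0 : ℝ) ≤ i := by positivity
    rw [show (i : ℝ) + 1 + s + 2 = (i + s + 2) + 1 by ring, Real.Gamma_add_one (by linarith)]
    have h := Real.Gamma_pos_of_pos (show 0 < i + s + 2 by linarith)
    have key : (2 * i + s + 3) * (b + (i + 1) + 1) ≤ (2 * (i + 1) + s + 3) * (i + s + 2) := by
      nlinarith
    nlinarith

theorem gammaRatio_div_Gamma_mono {s b : ℝ} (hs : -1 ≤ s) (hb : -1 < b) (hsb : -1 < s - b)
    {i m : ℕ} (him : i ≤ m) : gammaRatio s i / Real.Gamma (b + i + 1) ≤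
      gammaRatio s m / Real.Gamma (b + m + 1) :=
  monotone_nat_of_le_succ (f := fun i : ℕ => gammaRatio s i / Real.Gamma (b + i + 1))
    (gammaRatio_div_Gamma_mono_succ hs hb hsb) him

theorem jacobiInt_self_eq {α β : ℝ} (hα : -1 < α) (hβ : -1 < β) (hs : -1 ≤ α + β) (i : ℕ) :
    jacobiInt α β (jacobiPoly α β i * jacobiPoly α β i) =
      2 ^ (α + β + 1) * (Real.Gamma (α + i + 1) * Real.Gamma (β + i + 1)) /
        (i.factorial * gammaRatio (α + β) i) := by
  have h1 := (rising_add_self_pos hs i).ne'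
  have hi : (0 : ℝ) ≤ i := by positivity
  have h2 := (Real.Gamma_pos_of_pos (show 0 < α + β + 2 * i + 2 by linarith)).ne'
  rw [← add_assoc] at h1
  rw [jacobiInt_jacobiPoly_mul_self hα hβ, gammaRatio, ← add_assoc]
  field_simp

theorem jacobiInt_self_pos {α β : ℝ} (hα : -1 < α) (hβ : -1 < β) (hs : -1 ≤ α + β) (i : ℕ) :
    0 < jacobiInt α β (jacobiPoly α β i * jacobiPoly α β i) := by
  have hi : (0 : ℝ) ≤ i := by positivity
  have h1 := Real.Gamma_pos_of_pos (show 0 < α + i + 1 by linarith)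
  have h2 := Real.Gamma_pos_of_pos (show 0 < β + i + 1 by linarith)
  have h3 := gammaRatio_pos hs i
  rw [jacobiInt_self_eq hα hβ hs]
  positivity

/-- Since `Γ(q+i+1) = (q+1)_i Γ(q+1)`, end point value over norm depends on `i` only through a
quotient known to be monotone. -/
theorem rising_div_norm {q p : ℝ} (hq : -1 < q) (i : ℕ) :
    rising (q + 1) i / i.factorial / (2 ^ (q + p + 1) *
      (Real.Gamma (q + i + 1) * Real.Gamma (p + i + 1)) / (i.factorial * gammaRatio (q + p) i)) =
      gammaRatio (q + p) i / Real.Gamma (p + i + 1) / (2 ^ (q + p + 1) * Real.Gamma (q + 1)) := by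
  have h0 := Nat.factorial_ne_zero i
  have h1 := (Real.Gamma_pos_of_pos (show 0 < q + 1 by linarith)).ne'
  have h2 := (rising_pos (show 0 < q + 1 by linarith) i).ne'
  rw [show q + i + 1 = q + 1 + i by ring, ← rising_mul_Gamma (by linarith)]
  field_simp

theorem abs_eval_jacobiPoly_div_le {α β : ℝ} (hα : -1 < α) (hβ : -1 < β) (hs : -1 ≤ α + β)
    {i n : ℕ} (hn : 2 ≤ n) (hi : i < n) {x : ℝ} (hx : x ∈ Set.Icc (-1 : ℝ) 1) :
    |(jacobiPoly α β i).eval x| / jacobiInt α β (jacobiPoly α β i * jacobiPoly α β i) ≤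
      ((2 * (n : ℝ) + α + β + 1) / (2 : ℝ) ^ (α + β + 1))
            * realBinom (α + β + (n : ℝ) - 1) (max α β) := by
  -- Here `q` will be the larger of `α`, `β` and `p` the other.
  have key : ∀ q p : ℝ, -1 < q → -1 < p → q + p = α + β →
      rising (q + 1) i / i.factorial / (2 ^ (q + p + 1) *
      (Real.Gamma (q + i + 1) * Real.Gamma (p + i + 1)) / (i.factorial * gammaRatio (q + p) i)) ≤
      ((2 * (n : ℝ) + α + β + 1) / (2 : ℝ) ^ (α + β + 1))
            * realBinom (α + β + (n : ℝ) - 1) q := by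
    intro q p hq hp hqp
    obtain ⟨m, rfl⟩ := Nat.exists_eq_add_of_le' hn
    have hm : (0 : ℝ) ≤ m := by positivity
    rw [rising_div_norm hq, hqp]
    have hmono := gammaRatio_div_Gamma_mono (s := α + β) hs hp (by linarith)
      (show i ≤ m + 1 by omega)
    have hG := Real.Gamma_pos_of_pos (show 0 < q + 1 by linarith)
    have hP := Real.Gamma_pos_of_pos (show 0 < p + (m + 1) + 1 by linarith)
    have hS := Real.Gamma_pos_of_pos (show 0 < m + (α + β) + 2 by linarith)
    refine (div_le_div_of_nonneg_right hmono (by positivity)).trans ?_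
    rw [gammaRatio_succ hs, realBinom]
    push_cast
    rw [show α + β + (m + 2 : ℝ) - 1 + 1 = m + (α + β) + 2 by ring,
      show α + β + (m + 2 : ℝ) - 1 - q + 1 = p + (m + 1) + 1 by linarith, div_div,
      div_mul_div_comm, mul_left_comm (Real.Gamma _), mul_comm (Real.Gamma (p + (m + 1) + 1))]
    -- The exact factor at index `n - 1` is `2n + α + β - 1`; the stated one is larger by 2.
    exact div_le_div_of_nonneg_right (mul_le_mul_of_nonneg_right (by linarith) hS.le)
      (by positivity)
  rw [jacobiInt_self_eq hα hβ hs]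
  have hi0 : (0 : ℝ) ≤ i := by positivity
  have h1 := Real.Gamma_pos_of_pos (show 0 < α + i + 1 by linarith)
  have h2 := Real.Gamma_pos_of_pos (show 0 < β + i + 1 by linarith)
  have h3 := gammaRatio_pos hs i
  refine (div_le_div_of_nonneg_right (abs_eval_jacobiPoly_le hα hβ hs i hx)
    (by positivity)).trans ?_
  rcases le_total α β with h | h
  · rw [max_eq_right h]
    have := key β α hβ hα (add_comm _ _)
    rwa [add_comm β α, mul_comm (Real.Gamma (β + i + 1))] at this
  · rw [max_eq_left h]
    exact key α β hα hβ rfl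

theorem Gamma_mul_factorial_le {α : ℝ} (hα : -1 < α) (m : ℕ) :
    Real.Gamma (α + 2) * m.factorial ≤ Real.Gamma (m + α + 2) := by
  induction m with
  | zero => simp
  | succ m ih =>
    have hm : (0 : ℝ) ≤ m := by positivity
    have h := Real.Gamma_pos_of_pos (show 0 < m + α + 2 by linarith)
    rw [Nat.factorial_succ]
    push_cast
    rw [show (m : ℝ) + 1 + α + 2 = m + α + 2 + 1 by ring, Real.Gamma_add_one (by linarith)]
    nlinarith

theorem gammaRatio_le {s : ℝ} (hs : -1 ≤ s) (m : ℕ) :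
    gammaRatio s m ≤ 2 * Real.Gamma (m + s + 2) := by
  have hm : (0 : ℝ) ≤ m := by positivity
  have h := Real.Gamma_pos_of_pos (show 0 < m + s + 2 by linarith)
  rcases m with _ | m
  · simp [gammaRatio] at *
    linarith
  · have hm : (0 : ℝ) ≤ m := by positivity
    have h := Real.Gamma_pos_of_pos (show 0 < m + s + 2 by linarith)
    rw [gammaRatio_succ hs]
    push_cast
    rw [show (m : ℝ) + 1 + s + 2 = m + s + 2 + 1 by ring, Real.Gamma_add_one (by linarith)]
    nlinarith

/-- The contribution of the end point `1` to the coefficient of `P_i` is at most `2`. -/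
theorem endpoint_weight_mul_le {α β : ℝ} (hα : -1 < α) (hβ : -1 < β) (hs : -1 ≤ α + β)
    {i m : ℕ} (hi : i ≤ m) :
    jacobiInt α (β + 1) (jacobiPoly (α + 1) (β + 1) m) /
      (2 * (jacobiPoly (α + 1) (β + 1) m).eval 1) * (jacobiPoly α β i).eval 1 /
      jacobiInt α β (jacobiPoly α β i * jacobiPoly α β i) ≤ 2 := by
  have hm : (0 : ℝ) ≤ m := by positivity
  have hG1 := Real.Gamma_pos_of_pos (show 0 < α + 1 by linarith)
  have hG2 := Real.Gamma_pos_of_pos (show 0 < α + 2 by linarith)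
  have hGb := Real.Gamma_pos_of_pos (show 0 < β + m + 1 by linarith)
  have hGs := Real.Gamma_pos_of_pos (show 0 < m + (α + β) + 2 by linarith)
  have hGa := Real.Gamma_pos_of_pos (show 0 < m + α + 2 by linarith)
  have hmono := gammaRatio_div_Gamma_mono (s := α + β) hs hβ (by linarith) hi
  have hfac : (0 : ℝ) < m.factorial := by positivity
  have hr : rising (α + 2) m = Real.Gamma (m + α + 2) / Real.Gamma (α + 2) := by
    rw [eq_div_iff hG2.ne', rising_mul_Gamma (by linarith)]
    ring_nf
  rw [mul_div_assoc, eval_one_jacobiPoly α, jacobiInt_self_eq hα hβ hs, rising_div_norm hα,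
    jacobiInt_jacobiPoly m (by linarith) hα, eval_one_jacobiPoly, show α + 1 - α = 1 by ring,
    rising_one, show α + 1 + 1 = α + 2 by ring, hr, div_self hfac.ne', mul_one,
    show α + (β + 1) + 1 = α + β + 1 + 1 by ring, Real.rpow_add_one two_ne_zero,
    show β + 1 + m + 1 = β + m + 1 + 1 by ring,
    Real.Gamma_add_one (s := β + m + 1) (by linarith),
    show α + (β + 1) + m + 2 = m + (α + β) + 2 + 1 by ring,
    Real.Gamma_add_one (s := m + (α + β) + 2) (by linarith)]
  set S := Real.Gamma (m + (α + β) + 2)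
  set A := Real.Gamma (m + α + 2)
  set B := Real.Gamma (β + m + 1)
  set G := gammaRatio (α + β) i / Real.Gamma (β + i + 1)
  have hs2 : 0 < m + (α + β) + 2 := by linarith
  have hb1 : 0 < β + m + 1 := by linarith
  have hGle : G * B ≤ 2 * S := by
    rw [le_div_iff₀ hGb] at hmono
    exact hmono.trans (gammaRatio_le hs m)
  have h2 : (0 : ℝ) < 2 ^ (α + β + 1) := by positivity
  -- After cancellation three factors remain, bounded by 1, 1 and 2.
  have heq : 2 ^ (α + β + 1) * 2 * (Real.Gamma (α + 1) * ((β + m + 1) * B) /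
      ((m + (α + β) + 2) * S)) / (2 * (A / Real.Gamma (α + 2) / m.factorial)) *
      (G / (2 ^ (α + β + 1) * Real.Gamma (α + 1))) =
      (Real.Gamma (α + 2) * m.factorial / A) * ((β + m + 1) / (m + (α + β) + 2)) *
        (G * B / S) := by
    field_simp
  rw [heq]
  have e1 : Real.Gamma (α + 2) * m.factorial / A ≤ 1 :=
    (div_le_one hGa).mpr (Gamma_mul_factorial_le hα m)
  have e2 : (β + m + 1) / (m + (α + β) + 2) ≤ 1 := (div_le_one hs2).mpr (by linarith)
  have e3 : G * B / S ≤ 2 := (div_le_iff₀ hGs).mpr hGle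
  have e12 : Real.Gamma (α + 2) * m.factorial / A * ((β + m + 1) / (m + (α + β) + 2)) ≤ 1 :=
    mul_le_one₀ e1 (by positivity) e2
  have e120 : 0 ≤ Real.Gamma (α + 2) * m.factorial / A * ((β + m + 1) / (m + (α + β) + 2)) := by
    positivity
  nlinarith

/-! ### Expansion in Jacobi polynomials -/

theorem jacobiInt_mul_eq_zero_of_ne {α β : ℝ} (hα : -1 < α) (hβ : -1 < β) {i j : ℕ} (h : i ≠ j) :
    jacobiInt α β (jacobiPoly α β i * jacobiPoly α β j) = 0 := by
  rcases h.lt_or_gt with h | h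
  · exact jacobiInt_mul_jacobiPoly_of_natDegree_lt hα hβ ((natDegree_jacobiPoly_le _ _ _).trans_lt h)
  · rw [mul_comm]
    exact jacobiInt_mul_jacobiPoly_of_natDegree_lt hα hβ ((natDegree_jacobiPoly_le _ _ _).trans_lt h)

/-- If the degree dropped below `k`, `P_k` would be orthogonal to itself, against its positive norm.
-/
theorem coeff_jacobiPoly_self_ne_zero {α β : ℝ} (hα : -1 < α) (hβ : -1 < β) (hs : -1 ≤ α + β)
    (k : ℕ) : (jacobiPoly α β k).coeff k ≠ 0 := by
  rcases k with _ | k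
  · simp
  · intro h
    have hlt : (jacobiPoly α β (k + 1)).natDegree < k + 1 :=
      lt_of_le_of_ne (natDegree_jacobiPoly_le _ _ _) fun he => by
        have h' : (jacobiPoly α β (k + 1)).leadingCoeff = 0 := by rw [leadingCoeff, he, h]
        exact jacobiPoly_ne_zero hα _ (leadingCoeff_eq_zero.mp h')
    exact (jacobiInt_self_pos hα hβ hs (k + 1)).ne'
      (jacobiInt_mul_jacobiPoly_of_natDegree_lt hα hβ hlt)

theorem exists_jacobi_expansion {α β : ℝ} (hα : -1 < α) (hβ : -1 < β) (hs : -1 ≤ α + β) (n : ℕ) :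
    ∀ p : ℝ[X], p.natDegree ≤ n →
      ∃ c : ℕ → ℝ, p = ∑ i ∈ Finset.range (n + 1), C (c i) * jacobiPoly α β i := by
  induction n with
  | zero =>
    intro p hp
    refine ⟨fun _ => p.coeff 0, ?_⟩
    simpa using eq_C_of_natDegree_le_zero hp
  | succ n ih =>
    intro p hp
    set a := p.coeff (n + 1) / (jacobiPoly α β (n + 1)).coeff (n + 1) with ha
    obtain ⟨c, hc⟩ := ih (p - C a * jacobiPoly α β (n + 1)) (by
      rw [natDegree_le_iff_coeff_eq_zero]
      intro N hN
      rcases Nat.lt_iff_add_one_le.mp hN |>.eq_or_lt with rfl | hN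
      · rw [coeff_sub, coeff_C_mul, ha, div_mul_cancel₀ _ (coeff_jacobiPoly_self_ne_zero hα hβ hs _),
          sub_self]
      · rw [coeff_sub, coeff_C_mul, coeff_eq_zero_of_natDegree_lt (hp.trans_lt hN),
          coeff_eq_zero_of_natDegree_lt ((natDegree_jacobiPoly_le _ _ _).trans_lt hN)]
        simp)
    refine ⟨Function.update c (n + 1) a, ?_⟩
    rw [Finset.sum_range_succ, Function.update_self, ← sub_eq_iff_eq_add, hc]
    refine Finset.sum_congr rfl fun i hi => ?_
    rw [Function.update_of_ne (Finset.mem_range.mp hi).ne]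

/-! ### Gauss–Lobatto nodes, quadrature and weights -/

section Nodes

variable {α β : ℝ} {n : ℕ} {ρ : Fin (n + 1) → ℝ}

theorem mem_interiorIdx {j : Fin (n + 1)} : j ∈ interiorIdx n ↔ j ≠ 0 ∧ j ≠ Fin.last n := by
  simp [interiorIdx]

theorem IsJacobiNodes.mem_roots (h : IsJacobiNodes α β n ρ) {j : Fin (n + 1)}
    (hj : j ∈ interiorIdx n) : ρ j ∈ (jacobiPoly (α + 1) (β + 1) (n - 1)).roots := by
  rw [← h.interior]
  exact Multiset.mem_map_of_mem ρ hj

theorem IsJacobiNodes.mem_Ioo (h : IsJacobiNodes α β n ρ) (hα : -1 < α) (hβ : -1 < β)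
    {j : Fin (n + 1)} (hj : j ∈ interiorIdx n) : ρ j ∈ Set.Ioo (-1 : ℝ) 1 :=
  mem_Ioo_of_mem_roots_jacobiPoly (by linarith) (by linarith) (h.mem_roots hj)

theorem IsJacobiNodes.injective (h : IsJacobiNodes α β n ρ) (hα : -1 < α) (hβ : -1 < β) :
    Function.Injective ρ := by
  have hnd : ((interiorIdx n).val.map ρ).Nodup := by
    rw [h.interior]
    exact nodup_roots_jacobiPoly (by linarith) (by linarith) _
  have hinj := Multiset.inj_on_of_nodup_map hnd
  have hcases : ∀ j : Fin (n + 1), j = 0 ∨ j = Fin.last n ∨ j ∈ interiorIdx n := fun j => by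
    rw [mem_interiorIdx]; tauto
  intro i j hij
  rcases hcases i with rfl | rfl | hi <;> rcases hcases j with rfl | rfl | hj
  · rfl
  · rw [h.first, h.last] at hij; norm_num at hij
  · have := (h.mem_Ioo hα hβ hj).1
    rw [← hij, h.first] at this
    exact absurd this (lt_irrefl _)
  · rw [h.first, h.last] at hij; norm_num at hij
  · rfl
  · have := (h.mem_Ioo hα hβ hj).2
    rw [← hij, h.last] at this
    exact absurd this (lt_irrefl _)
  · have := (h.mem_Ioo hα hβ hi).1
    rw [hij, h.first] at this
    exact absurd this (lt_irrefl _)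
  · have := (h.mem_Ioo hα hβ hi).2
    rw [hij, h.last] at this
    exact absurd this (lt_irrefl _)
  · exact hinj i hi j hj hij

theorem zero_ne_last (hn : 1 ≤ n) : (0 : Fin (n + 1)) ≠ Fin.last n := by
  intro h
  have := congrArg Fin.val h
  simp at this
  omega

/-- The generality serves both the nodal polynomial and, through `Multiplicative ℝ`, row sums. -/
theorem prod_eq_interior {M : Type*} [CommMonoid M] (hn : 1 ≤ n) (f : Fin (n + 1) → M) :
    ∏ j, f j = f 0 * (f (Fin.last n) * ∏ j ∈ interiorIdx n, f j) := by
  have : (Finset.univ : Finset (Fin (n + 1))) = insert 0 (insert (Fin.last n) (interiorIdx n)) := by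
    ext j
    simp only [Finset.mem_univ, Finset.mem_insert, mem_interiorIdx, true_iff]
    tauto
  rw [this, Finset.prod_insert, Finset.prod_insert]
  · simp [mem_interiorIdx]
  · simp [mem_interiorIdx, zero_ne_last hn]

theorem sum_eq_interior (hn : 1 ≤ n) (f : Fin (n + 1) → ℝ) :
    ∑ j, f j = f 0 + (f (Fin.last n) + ∑ j ∈ interiorIdx n, f j) :=
  prod_eq_interior (M := Multiplicative ℝ) hn f

theorem IsJacobiNodes.jacobiPoly_eq_nodal (h : IsJacobiNodes α β n ρ) (hα : -1 < α)
    (hβ : -1 < β) : jacobiPoly (α + 1) (β + 1) (n - 1) =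
      C (jacobiPoly (α + 1) (β + 1) (n - 1)).leadingCoeff * Lagrange.nodal (interiorIdx n) ρ := by
  set Q := jacobiPoly (α + 1) (β + 1) (n - 1) with hQ
  have hcard : Q.roots.card = Q.natDegree := by
    have h1 : Q.roots.card = n - 1 := card_roots_jacobiPoly (by linarith) (by linarith) _
    have h2 : Q.natDegree ≤ n - 1 := natDegree_jacobiPoly_le _ _ _
    have h3 := card_roots' Q
    omega
  have hp := C_leadingCoeff_mul_prod_multiset_X_sub_C hcard
  rw [← h.interior, Multiset.map_map] at hp
  exact hp.symm

/-- The nodal polynomial is a multiple of `(1-x)(1+x)Q`; the two linear factors raise the weight to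
the one for which `Q` is orthogonal to lower degrees. -/
theorem IsJacobiNodes.jacobiInt_nodal_mul (h : IsJacobiNodes α β n ρ) (hn : 1 ≤ n) (hα : -1 < α)
    (hβ : -1 < β) {g : ℝ[X]} (hg : g.natDegree < n - 1) :
    jacobiInt α β (Lagrange.nodal Finset.univ ρ * g) = 0 := by
  set Q := jacobiPoly (α + 1) (β + 1) (n - 1) with hQ
  have hQ0 : Q.leadingCoeff ≠ 0 :=
    leadingCoeff_ne_zero.mpr (jacobiPoly_ne_zero (by linarith) _)
  have hnod : Lagrange.nodal (interiorIdx n) ρ = C Q.leadingCoeff⁻¹ * Q := by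
    have hQe : Q = C Q.leadingCoeff * Lagrange.nodal (interiorIdx n) ρ :=
      h.jacobiPoly_eq_nodal hα hβ
    calc Lagrange.nodal (interiorIdx n) ρ
        = C Q.leadingCoeff⁻¹ * (C Q.leadingCoeff * Lagrange.nodal (interiorIdx n) ρ) := by
          rw [← mul_assoc, ← C_mul, inv_mul_cancel₀ hQ0, C_1, one_mul]
      _ = C Q.leadingCoeff⁻¹ * Q := by rw [← hQe]
  have heq : Lagrange.nodal Finset.univ ρ * g =
      C (-Q.leadingCoeff⁻¹) * ((1 - X) * ((1 + X) * (g * Q))) := by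
    rw [Lagrange.nodal_eq, prod_eq_interior hn, ← Lagrange.nodal_eq, hnod, h.first, h.last]
    simp only [C_neg, C_1]
    ring
  rw [heq, jacobiInt_C_mul, jacobiInt_one_sub_mul, jacobiInt_one_add_mul,
    jacobiInt_mul_jacobiPoly_of_natDegree_lt (by linarith) (by linarith) hg, mul_zero]

/-- The Gauss-Lobatto quadrature rule, applied to a product with a Lagrange polynomial. -/
theorem IsJacobiNodes.jacobiInt_basis_mul (h : IsJacobiNodes α β n ρ) (hn : 1 ≤ n) (hα : -1 < α)
    (hβ : -1 < β) (j : Fin (n + 1)) {p : ℝ[X]} (hp : p.natDegree < n) :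
    jacobiInt α β (Lagrange.basis Finset.univ ρ j * p) =
      p.eval (ρ j) * jacobiInt α β (Lagrange.basis Finset.univ ρ j) := by
  -- Division by `X - ρ_j` splits off the value at the node; `ℓ_j (X - ρ_j)` is a multiple of the
  -- nodal polynomial, so the quotient part integrates to zero.
  set g := p /ₘ (X - C (ρ j)) with hg
  have hpg : p = C (p.eval (ρ j)) + (X - C (ρ j)) * g := by
    rw [hg, ← modByMonic_X_sub_C_eq_C_eval]
    exact (modByMonic_add_div p (X - C (ρ j))).symm
  have hgd : g.natDegree = p.natDegree - 1 := by
    rw [hg, natDegree_divByMonic _ (monic_X_sub_C _), natDegree_X_sub_C]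
  have hb : Lagrange.basis Finset.univ ρ j * (X - C (ρ j)) =
      C (Lagrange.nodalWeight Finset.univ ρ j) * Lagrange.nodal Finset.univ ρ := by
    rw [Lagrange.basis_eq_prod_sub_inv_mul_nodal_div (Finset.mem_univ j),
      ← Lagrange.nodal_erase_eq_nodal_div (Finset.mem_univ j), mul_assoc, mul_comm _ (X - C (ρ j)),
      ← Lagrange.nodal_eq_mul_nodal_erase (Finset.mem_univ j)]
  have heq : Lagrange.basis Finset.univ ρ j * p =
      C (p.eval (ρ j)) * Lagrange.basis Finset.univ ρ j +
        C (Lagrange.nodalWeight Finset.univ ρ j) * (Lagrange.nodal Finset.univ ρ * g) := by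
    conv_lhs => rw [hpg]
    linear_combination g * hb
  rw [heq, jacobiInt_add hα hβ, jacobiInt_C_mul, jacobiInt_C_mul]
  -- For constant `p` the quotient is 0, and its degree need not be below `n - 1` when `n = 1`.
  rcases Nat.eq_zero_or_pos p.natDegree with h0 | h0
  · have : g = 0 := by
      rw [hg, divByMonic_eq_zero_iff (monic_X_sub_C _), degree_X_sub_C]
      exact degree_le_natDegree.trans_lt (by rw [h0]; norm_num)
    simp [this, jacobiInt]
  · rw [h.jacobiInt_nodal_mul hn hα hβ (by omega)]
    ring

theorem eq_lagrange_basis (hρ : Function.Injective ρ) (j : Fin (n + 1)) {p : ℝ[X]}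
    (hp : p.natDegree ≤ n) (hj : p.eval (ρ j) = 1) (hk : ∀ k, k ≠ j → p.eval (ρ k) = 0) :
    Lagrange.basis Finset.univ ρ j = p := by
  refine eq_of_degrees_lt_of_eval_index_eq (s := Finset.univ) (v := ρ) hρ.injOn
    ?_ ?_ fun k _ => ?_
  · rw [Lagrange.degree_basis hρ.injOn (Finset.mem_univ j)]
    simp only [Finset.card_univ, Fintype.card_fin]
    exact_mod_cast Nat.lt_succ_self n
  · simp only [Finset.card_univ, Fintype.card_fin]
    exact degree_le_natDegree.trans_lt (by exact_mod_cast Nat.lt_succ_of_le hp)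
  · rcases eq_or_ne k j with rfl | hkj
    · rw [Lagrange.eval_basis_self hρ.injOn (Finset.mem_univ k), hj]
    · rw [Lagrange.eval_basis_of_ne hkj.symm (Finset.mem_univ k), hk k hkj]

theorem natDegree_one_add_X_mul_le (p : ℝ[X]) : ((1 + X) * p).natDegree ≤ p.natDegree + 1 := by
  refine natDegree_mul_le.trans ?_
  have : (1 + X : ℝ[X]).natDegree ≤ 1 := (natDegree_add_le _ _).trans (by simp)
  omega

theorem natDegree_one_sub_X_mul_le (p : ℝ[X]) : ((1 - X) * p).natDegree ≤ p.natDegree + 1 := by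
  refine natDegree_mul_le.trans ?_
  have : (1 - X : ℝ[X]).natDegree ≤ 1 := (natDegree_sub_le _ _).trans (by simp)
  omega

theorem IsJacobiNodes.eval_eq_zero (h : IsJacobiNodes α β n ρ) {j : Fin (n + 1)}
    (hj : j ∈ interiorIdx n) : (jacobiPoly (α + 1) (β + 1) (n - 1)).eval (ρ j) = 0 :=
  (mem_roots'.mp (h.mem_roots hj)).2

/-- `ℓ_j = (1 - x²) λ_j / (1 - ρ_j²)`, and `1 - x²` is absorbed into the weight. -/
theorem IsJacobiNodes.jacobiInt_basis_interior (h : IsJacobiNodes α β n ρ) (hn : 1 ≤ n)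
    (hα : -1 < α) (hβ : -1 < β) {j : Fin (n + 1)} (hj : j ∈ interiorIdx n) :
    jacobiInt α β (Lagrange.basis Finset.univ ρ j) =
      gaussJacobiWeight α β ρ j / (1 - ρ j ^ 2) := by
  have hρ := h.injective hα hβ
  have hI := h.mem_Ioo hα hβ hj
  have h0 : 1 - ρ j ^ 2 ≠ 0 := by nlinarith [hI.1, hI.2]
  rw [eq_lagrange_basis hρ j (p := C (1 - ρ j ^ 2)⁻¹ *
    ((1 - X) * ((1 + X) * Lagrange.basis (interiorIdx n) ρ j)))]
  · rw [jacobiInt_C_mul, jacobiInt_one_sub_mul, jacobiInt_one_add_mul, div_eq_inv_mul]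
    rfl
  · refine (natDegree_C_mul_le _ _).trans ((natDegree_one_sub_X_mul_le _).trans ?_)
    have h1 := natDegree_one_add_X_mul_le (Lagrange.basis (interiorIdx n) ρ j)
    rw [Lagrange.natDegree_basis hρ.injOn hj] at h1
    have h2 := card_interiorIdx hn
    have h3 := Finset.card_pos.mpr ⟨j, hj⟩
    omega
  · simp only [eval_mul, eval_C, eval_sub, eval_add, eval_one, eval_X,
      Lagrange.eval_basis_self hρ.injOn hj]
    field_simp
    ring
  · intro k hk
    by_cases hk' : k ∈ interiorIdx n
    · simp [Lagrange.eval_basis_of_ne hk.symm hk']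
    · rw [mem_interiorIdx, not_and_or, not_not, not_not] at hk'
      rcases hk' with rfl | rfl
      · simp [h.first]
      · simp [h.last]

/-- `ℓ_n = (1 + x) Q / (2 Q(1))`, whose integral has a closed form. -/
theorem IsJacobiNodes.jacobiInt_basis_last (h : IsJacobiNodes α β n ρ) (hn : 1 ≤ n)
    (hα : -1 < α) (hβ : -1 < β) :
    jacobiInt α β (Lagrange.basis Finset.univ ρ (Fin.last n)) =
      jacobiInt α (β + 1) (jacobiPoly (α + 1) (β + 1) (n - 1)) /
        (2 * (jacobiPoly (α + 1) (β + 1) (n - 1)).eval 1) := by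
  set Q := jacobiPoly (α + 1) (β + 1) (n - 1) with hQ
  have hQ1 : 0 < Q.eval 1 := eval_one_jacobiPoly_pos (by linarith) _
  rw [eq_lagrange_basis (h.injective hα hβ) (Fin.last n) (p := C (2 * Q.eval 1)⁻¹ * ((1 + X) * Q))]
  · rw [jacobiInt_C_mul, jacobiInt_one_add_mul, div_eq_inv_mul]
  · refine (natDegree_C_mul_le _ _).trans ((natDegree_one_add_X_mul_le _).trans ?_)
    have : Q.natDegree ≤ n - 1 := natDegree_jacobiPoly_le _ _ _
    omega
  · simp only [eval_mul, eval_C, eval_add, eval_one, eval_X, h.last]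
    field_simp
    norm_num
  · intro k hk
    rcases eq_or_ne k 0 with rfl | hk0
    · simp [h.first]
    · simp [hQ, h.eval_eq_zero (mem_interiorIdx.mpr ⟨hk0, hk⟩)]

theorem IsJacobiNodes.jacobiInt_basis_zero (h : IsJacobiNodes α β n ρ) (hn : 1 ≤ n)
    (hα : -1 < α) (hβ : -1 < β) :
    jacobiInt α β (Lagrange.basis Finset.univ ρ 0) =
      jacobiInt β (α + 1) (jacobiPoly (β + 1) (α + 1) (n - 1)) /
        (2 * (jacobiPoly (β + 1) (α + 1) (n - 1)).eval 1) := by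
  set Q := jacobiPoly (α + 1) (β + 1) (n - 1) with hQ
  set R := jacobiPoly (β + 1) (α + 1) (n - 1) with hR
  have hR1 : 0 < R.eval 1 := eval_one_jacobiPoly_pos (by linarith) _
  have hQR : Q.eval (-1) = (-1) ^ (n - 1) * R.eval 1 := eval_neg_jacobiPoly _ _ _ _
  have hcomp : R.comp (-X) = C ((-1) ^ (n - 1)) * Q := Polynomial.funext fun x => by
    rw [eval_comp, eval_neg, eval_X, hR, eval_neg_jacobiPoly, eval_C_mul]
  have hsq : ((-1 : ℝ) ^ (n - 1)) * (-1) ^ (n - 1) = 1 := by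
    rw [← mul_pow]; norm_num
  rw [eq_lagrange_basis (h.injective hα hβ) 0
    (p := C ((-1) ^ (n - 1) * (2 * R.eval 1)⁻¹) * ((1 - X) * Q))]
  · rw [jacobiInt_C_mul, jacobiInt_one_sub_mul, div_eq_inv_mul, ← jacobiInt_comp_neg _ _ R, hcomp,
      jacobiInt_C_mul]
    ring
  · refine (natDegree_C_mul_le _ _).trans ((natDegree_one_sub_X_mul_le _).trans ?_)
    have : Q.natDegree ≤ n - 1 := natDegree_jacobiPoly_le _ _ _
    omega
  · simp only [eval_mul, eval_C, eval_sub, eval_one, eval_X, h.first, hQR]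
    field_simp
    linear_combination 2 * hsq
  · intro k hk
    rcases eq_or_ne k (Fin.last n) with rfl | hk0
    · simp [h.last]
    · simp [hQ, h.eval_eq_zero (mem_interiorIdx.mpr ⟨hk, hk0⟩)]

theorem jacobiInt_self_symm (α β : ℝ) (i : ℕ) :
    jacobiInt α β (jacobiPoly α β i * jacobiPoly α β i) =
      jacobiInt β α (jacobiPoly β α i * jacobiPoly β α i) := by
  rw [← jacobiInt_comp_neg]
  congr 1
  refine Polynomial.funext fun x => ?_
  rw [eval_comp, eval_neg, eval_X, eval_mul, eval_neg_jacobiPoly, eval_mul]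
  have hsq : ((-1 : ℝ) ^ i) * (-1) ^ i = 1 := by
    rw [← mul_pow]; norm_num
  linear_combination ((jacobiPoly β α i).eval x) ^ 2 * hsq

/-! ### Entries of the coefficient matrix -/

variable {L : Matrix (Fin (n + 1)) (Fin (n + 1)) ℝ}

theorem IsLagrangeCoeffMatrix.apply_eq (hL : IsLagrangeCoeffMatrix (jacobiPoly α β) ρ L)
    (hα : -1 < α) (hβ : -1 < β) (hs : -1 ≤ α + β) (i j : Fin (n + 1)) :
    L i j = jacobiInt α β (Lagrange.basis Finset.univ ρ j * jacobiPoly α β i) /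
      jacobiInt α β (jacobiPoly α β i * jacobiPoly α β i) := by
  rw [eq_div_iff (jacobiInt_self_pos hα hβ hs i).ne', hL j, Finset.sum_mul, jacobiInt_sum hα hβ,
    Finset.sum_eq_single i]
  · rw [mul_assoc, jacobiInt_C_mul]
  · intro k _ hk
    rw [mul_assoc, jacobiInt_C_mul, jacobiInt_mul_eq_zero_of_ne hα hβ, mul_zero]
    exact fun h => hk (Fin.ext h)
  · simp

theorem IsJacobiNodes.existsUnique_lagrangeCoeffMatrix (h : IsJacobiNodes α β n ρ)
    (hα : -1 < α) (hβ : -1 < β) (hs : -1 ≤ α + β) :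
    ∃! L : Matrix (Fin (n + 1)) (Fin (n + 1)) ℝ,
      IsLagrangeCoeffMatrix (jacobiPoly α β) ρ L := by
  have hex : ∀ j, ∃ c : ℕ → ℝ, Lagrange.basis Finset.univ ρ j =
      ∑ i ∈ Finset.range (n + 1), C (c i) * jacobiPoly α β i := fun j =>
    exists_jacobi_expansion hα hβ hs n _ (by
      rw [Lagrange.natDegree_basis (h.injective hα hβ).injOn (Finset.mem_univ j)]
      simp)
  choose c hc using hex
  refine ⟨fun i j => c j i, fun j => ?_, fun L hL => ?_⟩
  · rw [hc j, Finset.sum_range]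
  · ext i j
    have hL' : IsLagrangeCoeffMatrix (jacobiPoly α β) ρ (fun i j : Fin (n + 1) => c j i) :=
      fun j => by rw [hc j, Finset.sum_range]
    rw [hL.apply_eq hα hβ hs, hL'.apply_eq hα hβ hs]

theorem IsJacobiNodes.apply_eq_of_lt (h : IsJacobiNodes α β n ρ)
    (hL : IsLagrangeCoeffMatrix (jacobiPoly α β) ρ L) (hn : 1 ≤ n)
    (hα : -1 < α) (hβ : -1 < β) (hs : -1 ≤ α + β) (i : Fin n) (j : Fin (n + 1)) :
    L i.castSucc j = jacobiInt α β (Lagrange.basis Finset.univ ρ j) *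
      (jacobiPoly α β i).eval (ρ j) / jacobiInt α β (jacobiPoly α β i * jacobiPoly α β i) := by
  rw [hL.apply_eq hα hβ hs, Fin.val_castSucc, h.jacobiInt_basis_mul hn hα hβ j
    ((natDegree_jacobiPoly_le _ _ _).trans_lt i.isLt), mul_comm (eval _ _)]

theorem jacobiInt_endpoint_nonneg {α β : ℝ} (hα : -1 < α) (hβ : -1 < β) (m : ℕ) :
    0 ≤ jacobiInt α (β + 1) (jacobiPoly (α + 1) (β + 1) m) := by
  have hm : (0 : ℝ) ≤ m := by positivity
  have h1 := Real.Gamma_pos_of_pos (show 0 < α + 1 by linarith)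
  have h2 := Real.Gamma_pos_of_pos (show 0 < β + 1 + m + 1 by linarith)
  have h3 := Real.Gamma_pos_of_pos (show 0 < α + (β + 1) + m + 2 by linarith)
  rw [jacobiInt_jacobiPoly m (by linarith) hα, show α + 1 - α = 1 by ring, rising_one]
  positivity

theorem IsJacobiNodes.abs_last_le (h : IsJacobiNodes α β n ρ)
    (hL : IsLagrangeCoeffMatrix (jacobiPoly α β) ρ L) (hn : 1 ≤ n)
    (hα : -1 < α) (hβ : -1 < β) (hs : -1 ≤ α + β) (i : Fin n) :
    |L i.castSucc (Fin.last n)| ≤ 2 := by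
  rw [h.apply_eq_of_lt hL hn hα hβ hs, h.jacobiInt_basis_last hn hα hβ, h.last, abs_of_nonneg]
  · exact endpoint_weight_mul_le hα hβ hs (by have := i.isLt; omega)
  · have h1 := jacobiInt_endpoint_nonneg hα hβ (n - 1)
    have h2 := eval_one_jacobiPoly_pos (β := β + 1) (show -1 < α + 1 by linarith) (n - 1)
    have h3 := eval_one_jacobiPoly_pos (β := β) hα i
    have h4 := jacobiInt_self_pos hα hβ hs i
    positivity

theorem IsJacobiNodes.abs_zero_le (h : IsJacobiNodes α β n ρ)
    (hL : IsLagrangeCoeffMatrix (jacobiPoly α β) ρ L) (hn : 1 ≤ n)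
    (hα : -1 < α) (hβ : -1 < β) (hs : -1 ≤ α + β) (i : Fin n) :
    |L i.castSucc 0| ≤ 2 := by
  have hs' : -1 ≤ β + α := by linarith
  have h1 := jacobiInt_endpoint_nonneg hβ hα (n - 1)
  have h2 := eval_one_jacobiPoly_pos (β := α + 1) (show -1 < β + 1 by linarith) (n - 1)
  have h3 := eval_one_jacobiPoly_pos (β := α) hβ i
  have h4 := jacobiInt_self_pos hβ hα hs' i
  rw [h.apply_eq_of_lt hL hn hα hβ hs, h.jacobiInt_basis_zero hn hα hβ, h.first,
    jacobiInt_self_symm, eval_neg_jacobiPoly, abs_div, abs_mul, abs_mul, abs_pow, abs_neg, abs_one,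
    one_pow, one_mul, abs_of_pos h3, abs_of_pos h4, abs_of_nonneg (by positivity)]
  exact endpoint_weight_mul_le hβ hα hs' (by have := i.isLt; omega)

theorem IsJacobiNodes.abs_interior_le (h : IsJacobiNodes α β n ρ)
    (hL : IsLagrangeCoeffMatrix (jacobiPoly α β) ρ L) (hn : 1 ≤ n)
    (hα : -1 < α) (hβ : -1 < β) (hs : -1 ≤ α + β) (i : Fin n) {j : Fin (n + 1)}
    (hj : j ∈ interiorIdx n) :
    |L i.castSucc j| ≤
      (⨆ j : {j : Fin (n + 1) // j ∈ interiorIdx n},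
                |gaussJacobiWeight α β ρ j / (1 - ρ j ^ 2)|) *
      (((2 * (n : ℝ) + α + β + 1) / (2 : ℝ) ^ (α + β + 1))
            * realBinom (α + β + (n : ℝ) - 1) (max α β)) := by
  -- An interior index exists only for `n ≥ 2`, the range of the polynomial bound.
  have hn2 : 2 ≤ n := by
    have h2 := card_interiorIdx hn
    have h3 := Finset.card_pos.mpr ⟨j, hj⟩
    omega
  rw [h.apply_eq_of_lt hL hn hα hβ hs, h.jacobiInt_basis_interior hn hα hβ hj, mul_div_assoc,
    abs_mul, abs_div (eval _ _), abs_of_pos (jacobiInt_self_pos hα hβ hs i)]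
  have hpos := jacobiInt_self_pos hα hβ hs i
  have hsup := le_ciSup (Set.finite_range fun j : {j : Fin (n + 1) // j ∈ interiorIdx n} =>
    |gaussJacobiWeight α β ρ j / (1 - ρ j ^ 2)|).bddAbove ⟨j, hj⟩
  refine mul_le_mul hsup (abs_eval_jacobiPoly_div_le hα hβ hs hn2 i.isLt
    (Set.Ioo_subset_Icc_self (h.mem_Ioo hα hβ hj))) (by positivity) ?_
  exact (abs_nonneg _).trans hsup

end Nodes

/-! ### The norm bound -/

theorem mainTheorem10 (n : ℕ) (hn : 1 ≤ n) (α β : ℝ) (hα : -1 < α) (hβ : -1 < β)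
    (hαβ : -1 ≤ α + β) :
    (∃ ρ : Fin (n + 1) → ℝ, IsJacobiNodes α β n ρ) ∧
    ∀ ρ : Fin (n + 1) → ℝ, IsJacobiNodes α β n ρ →
      (∃! L : Matrix (Fin (n + 1)) (Fin (n + 1)) ℝ,
        IsLagrangeCoeffMatrix (jacobiPoly α β) ρ L) ∧
      ∀ L : Matrix (Fin (n + 1)) (Fin (n + 1)) ℝ,
        IsLagrangeCoeffMatrix (jacobiPoly α β) ρ L →
        ‖firstRows L‖ ≤
          12 + ((n : ℝ) - 1)
            * (⨆ j : {j : Fin (n + 1) // j ∈ interiorIdx n},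
                |gaussJacobiWeight α β ρ j / (1 - ρ j ^ 2)|)
            * ((2 * (n : ℝ) + α + β + 1) / (2 : ℝ) ^ (α + β + 1))
            * realBinom (α + β + (n : ℝ) - 1) (max α β) := by
  refine ⟨exists_isJacobiNodes hα hβ hn, fun ρ h =>
    ⟨h.existsUnique_lagrangeCoeffMatrix hα hβ hαβ, fun L hL => ?_⟩⟩
  have : Nonempty (Fin n) := ⟨⟨0, hn⟩⟩
  -- Pick a row attaining the norm: its end points give at most `2 + 2 ≤ 12`, its `n - 1` interior
  -- entries the second term.
  obtain ⟨i, -, hi⟩ := Finset.exists_mem_eq_sup Finset.univ Finset.univ_nonempty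
    fun i => ∑ j, ‖firstRows L i j‖₊
  rw [Matrix.linfty_opNorm_def, hi, NNReal.coe_sum, sum_eq_interior hn]
  have h0 := h.abs_zero_le hL hn hα hβ hαβ i
  have h1 := h.abs_last_le hL hn hα hβ hαβ i
  have h2 := Finset.sum_le_card_nsmul (interiorIdx n) (fun j => |L i.castSucc j|) _
    fun j hj => h.abs_interior_le hL hn hα hβ hαβ i hj
  rw [card_interiorIdx hn, nsmul_eq_mul, Nat.cast_sub hn, Nat.cast_one] at h2
  simp only [firstRows, Matrix.submatrix_apply, id, coe_nnnorm, Real.norm_eq_abs]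
  rw [mul_assoc, mul_assoc]
  rw [← mul_assoc] at h2 ⊢
  linarith
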